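/- Let $n\ge 3$ be odd, let $1<\alpha<2$, and let $M$ be the antisymmetric $n\times n$ matrix which is block diagonal with $(n-1)/2$ blocks $\sigma=\begin{pmatrix}0&1\\-1&0\end{pmatrix}$ on the first $n-1$ coordinates and whose last row and last column vanish. Let $A(x)=|x|^{-\alpha}Mx$ on $\mathbb{R}^n$, and let $H=-(\nabla-iA)^2$ be the nonnegative self-adjoint operator on $L^2(\mathbb{R}^n)$ associated with the quadratic form $f\mapsto\|(\nabla-iA)f\|_{L^2}^2$ on the domain $\{f\in L^2:(\nabla-iA)f\in L^2\}$. Let $(p,q)\neq(\infty,2)$ be a pair of exponents in $[1,\infty]$ with $$\frac2p=\frac n2-\frac nq,\qquad p\ge 2 .$$ Then the Strichartz estimate with exponents $(p,q)$ fails for the equation $i\partial_tu+Hu=0$: there is no constant $C$ such that $$\|u\|_{L^p_t(\mathbb{R};L^q_x(\mathbb{R}^n))}\le C\|f\|_{L^2(\mathbb{R}^n)}$$ for every $f\in L^2(\mathbb{R}^n)$, where $u(t)=e^{itH}f$ is the solution with $u(0)=f$. -/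

import Mathlib

open MeasureTheory
open scoped ENNReal NNReal ContDiff Matrix InnerProductSpace

/-- The space `L²(ℝⁿ; ℂ)`. -/
abbrev L2 (n : ℕ) : Type := Lp ℂ 2 (volume : Measure (EuclideanSpace ℝ (Fin n)))

/-! ### The magnetic potential -/

/-- The `2 × 2` antisymmetric matrix `σ`. -/
def sigmaMatrix : Matrix (Fin 2) (Fin 2) ℝ := !![0, 1; -1, 0]

/-- `Ω_m` (`m` even): the block-diagonal `m × m` matrix whose diagonal blocks, occupying the
coordinates `2b, 2b + 1` (counted from `0`), are all equal to `σ`. -/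
def omegaMatrix (m : ℕ) : Matrix (Fin m) (Fin m) ℝ :=
  Matrix.of fun i j =>
    if (i : ℕ) / 2 = (j : ℕ) / 2 then sigmaMatrix (Fin.ofNat 2 i) (Fin.ofNat 2 j) else 0

/-- The `n × n` matrix `M` with upper left block `Ω_{n-1}`; the last row and the last column
vanish. -/
def magneticMatrix (n : ℕ) : Matrix (Fin n) (Fin n) ℝ :=
  Matrix.of fun i j =>
    if h : (i : ℕ) < n - 1 ∧ (j : ℕ) < n - 1 then
      omegaMatrix (n - 1) ⟨i, h.1⟩ ⟨j, h.2⟩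
    else 0

/-- The magnetic potential `A(x) = |x|^{-α} M x` (the value at the single point `0`, here `0`,
is irrelevant). -/
noncomputable def magneticPotential (n : ℕ) (α : ℝ) (x : EuclideanSpace ℝ (Fin n)) :
    EuclideanSpace ℝ (Fin n) :=
  WithLp.toLp 2 (‖x‖ ^ (-α) • (magneticMatrix n *ᵥ x.ofLp))

/-! ### The Hamiltonian `H = -(∇ - iA)²`

Below `A` is a (locally square integrable) real vector field on `ℝⁿ`. -/

/-- `G = (∇ - iA) f` in the sense of distributions, where `f` and all the components of `G`
are in `L²`: for every test function `φ ∈ C_c^∞(ℝⁿ; ℂ)` and every `j`,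
`∫ G_j φ = -∫ f (∂_j φ + i A_j φ)`. -/
def HasMagneticGradient {n : ℕ}
    (A : EuclideanSpace ℝ (Fin n) → EuclideanSpace ℝ (Fin n))
    (f : L2 n) (G : Fin n → L2 n) : Prop :=
  ∀ φ : EuclideanSpace ℝ (Fin n) → ℂ, ContDiff ℝ ∞ φ → HasCompactSupport φ → ∀ j : Fin n,
    ∫ x, G j x * φ x =
      -∫ x, f x * (fderiv ℝ φ x (EuclideanSpace.single j 1) + Complex.I * (A x j : ℂ) * φ x)

/-- `f` is in the domain of `H = -(∇ - iA)²` and `H f = g`. Here `H` is the nonnegative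
self-adjoint operator on `L²(ℝⁿ)` associated with the closed quadratic form
`f ↦ ‖(∇ - iA) f‖²_{L²}` on the form domain `{f ∈ L² : (∇ - iA) f ∈ L²}`: `f` is in the form
domain and `⟨(∇ - iA) φ, (∇ - iA) f⟩ = ⟨φ, g⟩` for all `φ` in the form domain. -/
def IsMagneticHamiltonian {n : ℕ}
    (A : EuclideanSpace ℝ (Fin n) → EuclideanSpace ℝ (Fin n)) (f g : L2 n) : Prop :=
  ∃ G : Fin n → L2 n, HasMagneticGradient A f G ∧
    ∀ (φ : L2 n) (Φ : Fin n → L2 n), HasMagneticGradient A φ Φ →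
      ∑ j, ⟪Φ j, G j⟫_ℂ = ⟪φ, g⟫_ℂ

/-- `u ∈ C(ℝ; L²)` is a solution of `i ∂_t u + H u = 0`, `u(0) = f`, with `f ∈ L²`. The
equation is tested against the domain of the self-adjoint operator `H`:
`d/dt ⟨φ, u(t)⟩ = i ⟨H φ, u(t)⟩` for all `φ` in the domain of `H`; the only such `u` is
`u(t) = e^{itH} f`. -/
def IsMagneticSchrodingerSolution {n : ℕ}
    (A : EuclideanSpace ℝ (Fin n) → EuclideanSpace ℝ (Fin n))
    (f : L2 n) (u : ℝ → L2 n) : Prop :=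
  Continuous u ∧ u 0 = f ∧
    ∀ φ ψ : L2 n, IsMagneticHamiltonian A φ ψ →
      ∀ t : ℝ, HasDerivAt (fun s => ⟪φ, u s⟫_ℂ) (Complex.I * ⟪ψ, u t⟫_ℂ) t

/-! ### Strichartz estimates -/

/-- The Schrödinger admissibility condition `2/p = n/2 - n/q`, `p ≥ 2`, and `p ≠ 2` if `n = 2`,
with exponents in `[0, ∞]` and `c / ∞ = 0`. -/
def SchrodingerAdmissible (n : ℕ) (p q : ℝ≥0∞) : Prop :=
  2 / p + n / q = n / 2 ∧ 2 ≤ p ∧ (n = 2 → p ≠ 2)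

/-- The mixed norm `‖u‖_{L^p_t L^q_x}` on `ℝ × ℝⁿ`, with values in `[0, ∞]`. -/
noncomputable def mixedNorm {n : ℕ} (p q : ℝ≥0∞) (u : ℝ → L2 n) : ℝ≥0∞ :=
  eLpNorm (fun t : ℝ => eLpNorm (u t) q volume) p volume

/-- The Strichartz estimate with exponents `(p, q)` for `i ∂_t u + H u = 0`: there is a constant
`C` such that `‖u‖_{L^p_t L^q_x} ≤ C ‖f‖_{L²}` for all data `f ∈ L²` and solutions `u`
with `u(0) = f`. -/
def StrichartzEstimate {n : ℕ}
    (A : EuclideanSpace ℝ (Fin n) → EuclideanSpace ℝ (Fin n)) (p q : ℝ≥0∞) : Prop :=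
  ∃ C : ℝ≥0, ∀ (f : L2 n) (u : ℝ → L2 n), IsMagneticSchrodingerSolution A f u →
    mixedNorm p q u ≤ C * ‖f‖ₑ

/-!
The operator `H` has long-lived, strongly localized states far out on the axis `ℝ e_n`, the kernel
of `M`. Near the point `R e_n` the field is nearly constant, `|A(x)|² = |x|^{-2α}|y|² ≈ b²|y|²` with
`b = R^{-α}` and `y` the `n - 1` coordinates orthogonal to the axis, and `A · ∇f` and `div (A f)`
vanish when `f` depends on `|y|` and `x_n` only (`sum_covariantDeriv_covariantDeriv`). On such
functions `H = -Δ + |A|²` is close to a harmonic oscillator in `y` with ground state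
`exp(-b|y|²/2)` and energy `(n - 1) b`, plus `-∂_n²`. The ground state, cut off to the ball of
radius `L` about `R e_n` (`quasimode`), satisfies `H f = (n - 1) b f + r` with `‖r‖ ≲ L⁻² ‖f‖` as
soon as `b⁻¹ ≤ L²` and `L³ ≤ R^{α + 1}` (`abs_quasimodeError_le`); the second condition says
that the variation of `b` over the support is at most of the order `L⁻²`.

Let `u(t) = e^{itH} f`. Since `⟪f, u(t)⟫` is `e^{i(n-1)bt} ‖f‖²` up to an error `|t| ‖r‖ ‖f‖`,
the overlap `|⟪f, u(t)⟫|` is at least `‖f‖² / 2` for times up to `T ∼ L²`, and Hölder's inequality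
gives `‖u(t)‖_q ≥ ‖f‖² / (2 ‖f‖_{q'})` there. A Strichartz estimate would thus imply
`T^{1/p} ‖f‖ ≲ ‖f‖_{q'}` (`rpow_mul_norm_le_of_strichartz`). As `f` is essentially the indicator of
a set of volume `V = b^{-(n-1)/2} L`, this reads `L^{2/p} ≲ V^{1/2 - 1/q} = V^{2/(np)}`
(`exists_rpow_le_of_strichartz`). With `L = R^γ` this fails for large `R` whenever `γ > α/2`, and
`γ` can be chosen with `α/2 < γ < (α + 1)/3`, because `α < 2`.

Only solutions that really exist can contradict the estimate, so `e^{itH} f` has to be constructed.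
This is done for any operator given by a closed, densely defined quadratic form
(`exists_formOperator_evolution`): the resolvents of `H` are read off from orthogonal projections
onto the graph of (a multiple of) the gradient, and `e^{itH} f` is the limit of `e^{itH_k} f`, where
the `H_k` are the bounded Yosida approximations of `H`. The form of `H` is closed because `A` is
locally square integrable, and densely defined because its domain contains all test functions
supported away from the origin, where `A` is smooth.
-/

/-! ### The unitary group of a closed quadratic form -/

section AbstractEvolution

open Filter Topology

variable {E F : Type*} [NormedAddCommGroup E] [InnerProductSpace ℂ E]
  [NormedAddCommGroup F] [InnerProductSpace ℂ F]

/-- The self-adjoint operator `H` (as a relation `H f = h`) associated with a closed quadratic form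
`‖∇ f‖²`, where the closed operator `∇` is given by its graph `V`: `f` has a gradient `G`, and
`⟪∇φ, ∇f⟫ = ⟪φ, h⟫` for all `φ` in the domain of `∇`. -/
def FormOperator (V : Submodule ℂ (WithLp 2 (E × F))) (f h : E) : Prop :=
  ∃ G : F, WithLp.toLp 2 (f, G) ∈ V ∧
    ∀ φ Φ, WithLp.toLp 2 (φ, Φ) ∈ V → ⟪Φ, G⟫_ℂ = ⟪φ, h⟫_ℂ

/-- `(φ, Ψ) ↦ (φ, a Ψ)`. -/
noncomputable def scaleSnd (E F : Type*) [NormedAddCommGroup E] [InnerProductSpace ℂ E]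
    [NormedAddCommGroup F] [InnerProductSpace ℂ F] (a : ℝ) :
    WithLp 2 (E × F) →L[ℂ] WithLp 2 (E × F) :=
  ((WithLp.prodContinuousLinearEquiv 2 ℂ E F).symm : E × F →L[ℂ] WithLp 2 (E × F)) ∘L
    ((ContinuousLinearMap.id ℂ E).prodMap ((a : ℂ) • ContinuousLinearMap.id ℂ F)) ∘L
    (WithLp.prodContinuousLinearEquiv 2 ℂ E F : WithLp 2 (E × F) →L[ℂ] E × F)

@[simp] lemma scaleSnd_apply (a : ℝ) (x : E) (y : F) :
    scaleSnd E F a (WithLp.toLp 2 (x, y)) = WithLp.toLp 2 (x, (a : ℂ) • y) := rfl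

/-- The graph of `a⁻¹ ∇`, where `V` is the graph of `∇`. -/
noncomputable def scaledGraph (V : Submodule ℂ (WithLp 2 (E × F))) (a : ℝ) :
    Submodule ℂ (WithLp 2 (E × F)) :=
  V.comap (scaleSnd E F a).toLinearMap

lemma mem_scaledGraph {V : Submodule ℂ (WithLp 2 (E × F))} {a : ℝ} {x : E} {y : F} :
    WithLp.toLp 2 (x, y) ∈ scaledGraph V a ↔ WithLp.toLp 2 (x, (a : ℂ) • y) ∈ V := Iff.rfl

lemma isClosed_scaledGraph {V : Submodule ℂ (WithLp 2 (E × F))}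
    (hV : IsClosed (V : Set (WithLp 2 (E × F)))) (a : ℝ) :
    IsClosed (scaledGraph V a : Set (WithLp 2 (E × F))) :=
  hV.preimage (scaleSnd E F a).continuous

/-- The resolvent `(1 + a⁻² H)⁻¹`: the first component of the orthogonal projection of `(g, 0)`
onto the graph of `a⁻¹ ∇`. -/
noncomputable def formResolvent (V : Submodule ℂ (WithLp 2 (E × F))) (a : ℝ)
    [(scaledGraph V a).HasOrthogonalProjection] : E →L[ℂ] E :=
  WithLp.fstL 2 ℂ E F ∘L (scaledGraph V a).starProjection ∘L
    ((WithLp.prodContinuousLinearEquiv 2 ℂ E F).symm : E × F →L[ℂ] WithLp 2 (E × F)) ∘L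
    ContinuousLinearMap.inl ℂ E F

section Resolvent

variable (V : Submodule ℂ (WithLp 2 (E × F))) (a : ℝ) [(scaledGraph V a).HasOrthogonalProjection]

lemma formResolvent_apply (g : E) : formResolvent V a g =
    ((scaledGraph V a).starProjection (WithLp.toLp 2 (g, 0))).fst := rfl

lemma inner_formResolvent_left (g h : E) :
    ⟪formResolvent V a g, h⟫_ℂ = ⟪g, formResolvent V a h⟫_ℂ := by
  have := Submodule.inner_starProjection_left_eq_right (scaledGraph V a)
    (WithLp.toLp 2 (g, 0)) (WithLp.toLp 2 (h, 0))
  simpa [WithLp.prod_inner_apply, formResolvent_apply] using this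

lemma norm_formResolvent_apply_le (g : E) : ‖formResolvent V a g‖ ≤ ‖g‖ := by
  rw [formResolvent_apply]
  refine (WithLp.norm_fst_le _ _).trans ?_
  refine (Submodule.norm_starProjection_apply_le _ _).trans ?_
  rw [WithLp.norm_toLp_fst]

variable {V a}

lemma formOperator_formResolvent (ha : a ≠ 0) (g : E) :
    FormOperator V (formResolvent V a g) ((a : ℂ) ^ 2 • (g - formResolvent V a g)) := by
  have ha' : (a : ℂ) ≠ 0 := by exact_mod_cast ha
  set w := (scaledGraph V a).starProjection (WithLp.toLp 2 (g, 0)) with hw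
  have hmem : WithLp.toLp 2 (w.fst, w.snd) ∈ scaledGraph V a :=
    Submodule.starProjection_apply_mem _ _
  refine ⟨(a : ℂ) • w.snd, mem_scaledGraph.1 hmem, fun φ Φ hφ => ?_⟩
  have h1 : WithLp.toLp 2 (φ, (a : ℂ)⁻¹ • Φ) ∈ scaledGraph V a := by
    rw [mem_scaledGraph, smul_smul, mul_inv_cancel₀ ha', one_smul]; exact hφ
  have h2 := Submodule.sub_starProjection_mem_orthogonal (K := scaledGraph V a)
    (WithLp.toLp 2 (g, (0 : F)))
  have h3 := (Submodule.mem_orthogonal _ _).1 h2 _ h1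
  rw [← hw] at h3
  simp only [WithLp.prod_inner_apply, WithLp.ofLp_sub, Prod.fst_sub, Prod.snd_sub, zero_sub,
    inner_neg_right, inner_smul_left, WithLp.ofLp_fst, WithLp.ofLp_snd, map_inv₀,
    Complex.conj_ofReal] at h3
  rw [inner_smul_right, inner_smul_right, formResolvent_apply, ← hw]
  have h4 : ⟪φ, g - w.fst⟫_ℂ = (a : ℂ)⁻¹ * ⟪Φ, w.snd⟫_ℂ := by linear_combination h3
  rw [h4]; field_simp

/-- `(1 + a⁻² H)⁻¹ (f + a⁻² H f) = f`. -/
lemma formResolvent_add_smul (ha : a ≠ 0) {f h : E} (hf : FormOperator V f h) :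
    formResolvent V a (f + ((a : ℂ) ^ 2)⁻¹ • h) = f := by
  have ha' : (a : ℂ) ≠ 0 := by exact_mod_cast ha
  obtain ⟨G, hG, hGφ⟩ := hf
  have h1 : WithLp.toLp 2 (f, (a : ℂ)⁻¹ • G) ∈ scaledGraph V a := by
    rw [mem_scaledGraph, smul_smul, mul_inv_cancel₀ ha', one_smul]; exact hG
  suffices hs : WithLp.toLp 2 (f + ((a : ℂ) ^ 2)⁻¹ • h, (0 : F)) -
      WithLp.toLp 2 (f, (a : ℂ)⁻¹ • G) ∈ (scaledGraph V a)ᗮ by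
    rw [formResolvent_apply, Submodule.eq_starProjection_of_mem_orthogonal h1 hs,
      WithLp.toLp_fst]
  rw [Submodule.mem_orthogonal]
  rintro u hu
  have hu' : WithLp.toLp 2 (u.fst, (a : ℂ) • u.snd) ∈ V := mem_scaledGraph.1 hu
  have h2 := hGφ _ _ hu'
  rw [inner_smul_left, Complex.conj_ofReal] at h2
  simp only [WithLp.prod_inner_apply, WithLp.ofLp_sub, Prod.fst_sub, Prod.snd_sub, zero_sub,
    inner_neg_right, WithLp.ofLp_fst, WithLp.ofLp_snd, inner_smul_right, add_sub_cancel_left]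
  rw [← h2]; field_simp; ring

/-- The Yosida approximation `a² (1 - (1 + a⁻² H)⁻¹)` of `H`, applied to `f`, is
`(1 + a⁻² H)⁻¹ H f`. -/
lemma sq_smul_sub_formResolvent (ha : a ≠ 0) {f h : E} (hf : FormOperator V f h) :
    (a : ℂ) ^ 2 • (f - formResolvent V a f) = formResolvent V a h := by
  have ha' : (a : ℂ) ≠ 0 := by exact_mod_cast ha
  have := formResolvent_add_smul ha hf
  rw [map_add, map_smul] at this
  nth_rw 1 [← this]
  rw [add_sub_cancel_left, smul_smul, mul_inv_cancel₀ (pow_ne_zero 2 ha'), one_smul]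

/-- The projection of `(f, 0)` onto the graph of `a⁻¹ ∇` is at least as close to `(f, 0)` as
`(f, a⁻¹ ∇f)`. -/
lemma norm_sub_formResolvent_le (ha : 0 < a) {f : E} {G : F} (hG : WithLp.toLp 2 (f, G) ∈ V) :
    ‖f - formResolvent V a f‖ ≤ a⁻¹ * ‖G‖ := by
  have ha' : (a : ℂ) ≠ 0 := by exact_mod_cast ha.ne'
  have h1 : WithLp.toLp 2 (f, (a : ℂ)⁻¹ • G) ∈ scaledGraph V a := by
    rw [mem_scaledGraph, smul_smul, mul_inv_cancel₀ ha', one_smul]; exact hG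
  have h2 := Submodule.starProjection_minimal (U := scaledGraph V a) (WithLp.toLp 2 (f, (0 : F)))
  have h3 := ciInf_le (f := fun x : scaledGraph V a => ‖WithLp.toLp 2 (f, (0 : F)) - x‖)
    ⟨0, by rintro _ ⟨x, rfl⟩; positivity⟩ ⟨_, h1⟩
  have h4 : WithLp.toLp 2 (f, (0 : F)) - WithLp.toLp 2 (f, (a : ℂ)⁻¹ • G) =
      WithLp.toLp 2 (0, -((a : ℂ)⁻¹ • G)) := by
    rw [← WithLp.toLp_sub, Prod.mk_sub_mk, sub_self, zero_sub]
  dsimp only at h3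
  rw [← h2, h4, WithLp.norm_toLp_snd] at h3
  refine (WithLp.norm_fst_le _ (WithLp.toLp 2 (f, (0 : F)) -
    (scaledGraph V a).starProjection (WithLp.toLp 2 (f, 0)))).trans (h3.trans_eq ?_)
  rw [norm_neg, norm_smul, norm_inv, Complex.norm_real, Real.norm_of_nonneg ha.le]

lemma commute_formResolvent {b : ℝ} [(scaledGraph V b).HasOrthogonalProjection]
    (ha : 0 < a) (hb : 0 < b) : Commute (formResolvent V a) (formResolvent V b) := by
  rcases eq_or_ne a b with rfl | hab
  · exact Commute.refl _
  -- The resolvent identity.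
  have key : ∀ {a b : ℝ} [(scaledGraph V a).HasOrthogonalProjection]
      [(scaledGraph V b).HasOrthogonalProjection] (_ : 0 < a) (_ : 0 < b) (g : E),
      ((b : ℂ) ^ 2 - (a : ℂ) ^ 2) • formResolvent V b (formResolvent V a g) =
        (b : ℂ) ^ 2 • formResolvent V a g - (a : ℂ) ^ 2 • formResolvent V b g := by
    intro a b _ _ ha hb g
    have := sq_smul_sub_formResolvent hb.ne' (formOperator_formResolvent (V := V) ha.ne' g)
    rw [map_smul, map_sub, smul_sub, smul_sub] at this
    rw [← sub_eq_zero] at this ⊢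
    rw [← neg_eq_zero, ← this]
    module
  ext g
  have h1 := key ha hb g
  have h2 := key hb ha g
  have hne : ((a : ℂ) ^ 2 - (b : ℂ) ^ 2) ≠ 0 := by
    have : a ^ 2 - b ^ 2 ≠ 0 := by
      intro h
      exact hab ((sq_eq_sq₀ ha.le hb.le).1 (sub_eq_zero.1 h))
    exact_mod_cast this
  refine smul_right_injective _ hne ?_
  change ((a : ℂ) ^ 2 - (b : ℂ) ^ 2) • formResolvent V a (formResolvent V b g) =
    ((a : ℂ) ^ 2 - (b : ℂ) ^ 2) • formResolvent V b (formResolvent V a g)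
  rw [h2, ← neg_sub ((b : ℂ) ^ 2), neg_smul, h1, neg_sub]

end Resolvent

section Exp

variable [CompleteSpace E]

lemma norm_exp_smul_I_apply {B : E →L[ℂ] E} (hB : IsSelfAdjoint B) (t : ℝ) (f : E) :
    ‖NormedSpace.exp (t • (Complex.I • B)) f‖ = ‖f‖ := by
  have hs : IsSelfAdjoint (t • B) := (IsSelfAdjoint.all t).smul hB
  have h := (selfAdjoint.expUnitary (⟨t • B, hs⟩ : selfAdjoint (E →L[ℂ] E))).2
  rw [selfAdjoint.expUnitary_coe] at h
  rw [smul_comm]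
  simpa using ContinuousLinearMap.norm_map_of_mem_unitary h f

lemma hasDerivAt_exp_smul_I_apply (B : E →L[ℂ] E) (t : ℝ) (f : E) :
    HasDerivAt (fun s : ℝ => NormedSpace.exp (s • (Complex.I • B)) f)
      (Complex.I • B (NormedSpace.exp (t • (Complex.I • B)) f)) t := by
  have h := hasDerivAt_exp_smul_const' (𝕂 := ℝ) (Complex.I • B) t
  exact ((ContinuousLinearMap.apply ℂ E f).restrictScalars ℝ).hasFDerivAt.comp_hasDerivAt t h

lemma exp_smul_I_apply_comm {B D : E →L[ℂ] E} (h : Commute B D) (t : ℝ) (f : E) :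
    D (NormedSpace.exp (t • (Complex.I • B)) f) = NormedSpace.exp (t • (Complex.I • B)) (D f) := by
  have h1 : Commute (NormedSpace.exp (t • (Complex.I • B))) D :=
    ((h.smul_left Complex.I).smul_left t).exp_left
  exact (DFunLike.congr_fun h1.eq f).symm

lemma norm_exp_smul_I_apply_sub_le {B : E →L[ℂ] E} (hB : IsSelfAdjoint B) (s t : ℝ) (f : E) :
    ‖NormedSpace.exp (t • (Complex.I • B)) f - NormedSpace.exp (s • (Complex.I • B)) f‖ ≤
      ‖B f‖ * |t - s| :=
  Convex.norm_image_sub_le_of_norm_hasDerivWithin_le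
    (f := fun s : ℝ => NormedSpace.exp (s • (Complex.I • B)) f) (C := ‖B f‖) (s := Set.univ)
    (fun s _ => (hasDerivAt_exp_smul_I_apply B s f).hasDerivWithinAt) (fun s _ => by
      rw [exp_smul_I_apply_comm (Commute.refl B), norm_smul, Complex.norm_I, one_mul,
        norm_exp_smul_I_apply hB]) convex_univ (Set.mem_univ _) (Set.mem_univ _)

lemma norm_exp_smul_I_sub_exp_smul_I_le {B D : E →L[ℂ] E} (hB : IsSelfAdjoint B)
    (hD : IsSelfAdjoint D) (h : Commute B D) (t : ℝ) (f : E) :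
    ‖NormedSpace.exp (t • (Complex.I • B)) f - NormedSpace.exp (t • (Complex.I • D)) f‖ ≤
      ‖B f - D f‖ * |t| := by
  have h1 : t • (Complex.I • B) = t • (Complex.I • D) + t • (Complex.I • (B - D)) := by
    rw [smul_sub, smul_sub]; abel
  have hc : Commute (t • (Complex.I • D)) (t • (Complex.I • (B - D))) := by
    have : Commute D (B - D) := h.symm.sub_right (Commute.refl D)
    exact ((((this.smul_left Complex.I).smul_left t).smul_right Complex.I).smul_right t)
  let : NormedAlgebra ℚ (E →L[ℂ] E) := NormedAlgebra.restrictScalars ℚ ℂ _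
  rw [h1, NormedSpace.exp_add_of_commute hc, mul_apply_eq_comp, ← map_sub,
    norm_exp_smul_I_apply hD]
  simpa using norm_exp_smul_I_apply_sub_le (hB.sub hD) 0 t f

end Exp

section Existence

variable [CompleteSpace E] {V : Submodule ℂ (WithLp 2 (E × F))}

/-- The resolvents `(1 + a⁻² H)⁻¹` tend strongly to the identity, if the domain of `∇` is dense
(the hypothesis says that its orthogonal complement is trivial). -/
lemma tendsto_formResolvent [∀ a, (scaledGraph V a).HasOrthogonalProjection]
    (hdense : ∀ g : E, (∀ φ Φ, WithLp.toLp 2 (φ, Φ) ∈ V → ⟪φ, g⟫_ℂ = 0) → g = 0) (g : E) :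
    Tendsto (fun k : ℕ => formResolvent V (k + 1) g) atTop (𝓝 g) := by
  set W : Submodule ℂ E := V.map (WithLp.fstL 2 ℂ E F).toLinearMap with hW
  have hWd : W.topologicalClosure = ⊤ := by
    rw [Submodule.topologicalClosure_eq_top_iff, Submodule.eq_bot_iff]
    intro x hx
    refine hdense x fun φ Φ hφ => ?_
    exact (Submodule.mem_orthogonal _ _).1 hx _ ⟨_, hφ, rfl⟩
  rw [Metric.tendsto_atTop]
  intro ε hε
  have hg : g ∈ closure (W : Set E) := by
    rw [← Submodule.topologicalClosure_coe, hWd]; trivial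
  obtain ⟨w, hw, hgw⟩ := Metric.mem_closure_iff.1 hg (ε / 3) (by positivity)
  obtain ⟨x, hx, rfl⟩ := hw
  have hx' : WithLp.toLp 2 (x.fst, x.snd) ∈ V := hx
  change dist g x.fst < _ at hgw
  obtain ⟨N, hN⟩ := exists_nat_gt (‖x.snd‖ / (ε / 3))
  refine ⟨N, fun k hk => ?_⟩
  have hk' : (N : ℝ) ≤ k := by exact_mod_cast hk
  have h1 := norm_sub_formResolvent_le (a := (k : ℝ) + 1) (by positivity) hx'
  have h2 : ((k : ℝ) + 1)⁻¹ * ‖x.snd‖ < ε / 3 := by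
    rw [inv_mul_lt_iff₀ (by positivity)]
    rw [div_lt_iff₀ (by positivity)] at hN
    nlinarith
  have h3 := norm_formResolvent_apply_le V ((k : ℝ) + 1) (g - x.fst)
  rw [dist_eq_norm] at hgw ⊢
  have h4 : formResolvent V ((k : ℝ) + 1) g - g = formResolvent V ((k : ℝ) + 1) (g - x.fst) -
      (x.fst - formResolvent V ((k : ℝ) + 1) x.fst) - (g - x.fst) := by
    rw [map_sub]; abel
  rw [h4]
  have h5 := norm_sub_le (formResolvent V ((k : ℝ) + 1) (g - x.fst) -
      (x.fst - formResolvent V ((k : ℝ) + 1) x.fst)) (g - x.fst)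
  have h6 := norm_sub_le (formResolvent V ((k : ℝ) + 1) (g - x.fst))
      (x.fst - formResolvent V ((k : ℝ) + 1) x.fst)
  linarith

/-- Existence of `e^{itH} f` for `f` in the domain of `H`, as the limit of `e^{itH_k} f`, with
`H_k` the Yosida approximations of `H`. -/
theorem exists_formOperator_evolution [CompleteSpace F]
    (hV : IsClosed (V : Set (WithLp 2 (E × F))))
    (hdense : ∀ g : E, (∀ φ Φ, WithLp.toLp 2 (φ, Φ) ∈ V → ⟪φ, g⟫_ℂ = 0) → g = 0)
    {f h : E} (hf : FormOperator V f h) :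
    ∃ u : ℝ → E, Continuous u ∧ u 0 = f ∧ (∀ t, ‖u t‖ = ‖f‖) ∧
      ∀ φ ψ, FormOperator V φ ψ → ∀ t : ℝ,
        HasDerivAt (fun s => ⟪φ, u s⟫_ℂ) (Complex.I * ⟪ψ, u t⟫_ℂ) t := by
  have : ∀ a, (scaledGraph V a).HasOrthogonalProjection := fun a => by
    have : CompleteSpace (scaledGraph V a) := (isClosed_scaledGraph hV a).completeSpace_coe
    infer_instance
  set J : ℕ → E →L[ℂ] E := fun k => formResolvent V (k + 1) with hJ
  have hJlim : ∀ g, Tendsto (fun k => J k g) atTop (𝓝 g) := tendsto_formResolvent hdense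
  have hpos : ∀ k : ℕ, (0 : ℝ) < k + 1 := fun k => by positivity
  set Y : ℕ → E →L[ℂ] E := fun k => ((((k : ℝ) + 1) ^ 2 : ℝ) : ℂ) • (1 - J k) with hY
  have hYJ : ∀ k φ ψ, FormOperator V φ ψ → Y k φ = J k ψ := by
    intro k φ ψ hφ
    rw [hJ, ← sq_smul_sub_formResolvent (hpos k).ne' hφ, hY]
    push_cast
    rfl
  have hYsa : ∀ k, IsSelfAdjoint (Y k) := by
    intro k
    have hJsa : IsSelfAdjoint (J k) := by
      rw [ContinuousLinearMap.isSelfAdjoint_iff_isSymmetric]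
      exact inner_formResolvent_left V _
    refine IsSelfAdjoint.smul ?_ ((IsSelfAdjoint.one _).sub hJsa)
    exact Complex.conj_ofReal _
  have hYc : ∀ k l, Commute (Y k) (Y l) := by
    intro k l
    have h1 : Commute (J k) (J l) := commute_formResolvent (hpos k) (hpos l)
    have h2 : Commute (1 - J k) (1 - J l) :=
      ((Commute.one_left _).sub_left ((Commute.one_right _).sub_right h1))
    exact (h2.smul_left _).smul_right _
  set U : ℕ → ℝ → E := fun k t => NormedSpace.exp (t • (Complex.I • Y k)) f with hU
  have hUnorm : ∀ k t, ‖U k t‖ = ‖f‖ := fun k t => norm_exp_smul_I_apply (hYsa k) t f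
  have hUU : ∀ k l t, ‖U k t - U l t‖ ≤ ‖J k h - J l h‖ * |t| := by
    intro k l t
    have := norm_exp_smul_I_sub_exp_smul_I_le (hYsa k) (hYsa l) (hYc k l) t f
    rwa [hYJ k f h hf, hYJ l f h hf] at this
  have hcauchy : ∀ t, CauchySeq fun k => U k t := by
    intro t
    have h1 : CauchySeq fun k => J k h := (hJlim h).cauchySeq
    rw [Metric.cauchySeq_iff] at h1 ⊢
    intro ε hε
    obtain ⟨N, hN⟩ := h1 (ε / (|t| + 1)) (by positivity)
    refine ⟨N, fun k hk l hl => ?_⟩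
    have h2 := hN k hk l hl
    rw [dist_eq_norm, lt_div_iff₀ (by positivity)] at h2
    rw [dist_eq_norm]
    refine lt_of_le_of_lt (hUU k l t) (lt_of_le_of_lt ?_ h2)
    gcongr
    linarith
  choose u hu using fun t => cauchySeq_tendsto_of_complete (hcauchy t)
  have hUu : ∀ k t, ‖U k t - u t‖ ≤ ‖J k h - h‖ * |t| := by
    intro k t
    refine le_of_tendsto_of_tendsto ((tendsto_const_nhds.sub (hu t)).norm)
      (((tendsto_const_nhds.sub (hJlim h)).norm).mul_const |t|)
      (Eventually.of_forall fun l => hUU k l t)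
  have hunorm : ∀ t, ‖u t‖ = ‖f‖ := by
    intro t
    have := (hu t).norm
    simp only [hUnorm] at this
    exact tendsto_nhds_unique tendsto_const_nhds this |>.symm
  have hulip : ∀ s t, ‖u t - u s‖ ≤ ‖h‖ * |t - s| := by
    intro s t
    refine le_of_tendsto ((hu t).sub (hu s)).norm (Eventually.of_forall fun k => ?_)
    refine (norm_exp_smul_I_apply_sub_le (hYsa k) s t f).trans ?_
    rw [hYJ k f h hf]
    gcongr
    exact norm_formResolvent_apply_le V _ h
  refine ⟨u, ?_, ?_, hunorm, ?_⟩
  · refine (LipschitzWith.of_dist_le_mul (K := ‖h‖₊) fun t s => ?_).continuous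
    rw [dist_eq_norm, dist_eq_norm, Real.norm_eq_abs]
    exact hulip s t
  · refine tendsto_nhds_unique (hu 0) ?_
    simp [hU]
  · intro φ ψ hφ t
    have hder : ∀ k s, HasDerivAt (fun s => ⟪φ, U k s⟫_ℂ) (Complex.I * ⟪J k ψ, U k s⟫_ℂ) s := by
      intro k s
      have h1 := (hasDerivAt_const s φ).inner ℂ (hasDerivAt_exp_smul_I_apply (Y k) s f)
      rw [inner_zero_left, add_zero, inner_smul_right] at h1
      rw [← hYJ k φ ψ hφ]
      have h2 : ⟪Y k φ, U k s⟫_ℂ = ⟪φ, Y k (U k s)⟫_ℂ :=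
        (ContinuousLinearMap.isSelfAdjoint_iff_isSymmetric.1 (hYsa k)) _ _
      rw [h2]
      exact h1
    have hunif : TendstoUniformlyOn (fun k s => Complex.I * ⟪J k ψ, U k s⟫_ℂ)
        (fun s => Complex.I * ⟪ψ, u s⟫_ℂ) atTop (Metric.ball 0 (|t| + 1)) := by
      have hδ : Tendsto (fun k => ‖J k ψ - ψ‖ * ‖f‖ + ‖ψ‖ * (‖J k h - h‖ * (|t| + 1)))
          atTop (𝓝 0) := by
        have h1 : ∀ g, Tendsto (fun k => ‖J k g - g‖) atTop (𝓝 0) := fun g => by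
          rw [← tendsto_iff_norm_sub_tendsto_zero]; exact hJlim g
        have := ((h1 ψ).mul_const ‖f‖).add (((h1 h).mul_const (|t| + 1)).const_mul ‖ψ‖)
        simpa using this
      rw [Metric.tendstoUniformlyOn_iff]
      intro ε hε
      filter_upwards [hδ.eventually (gt_mem_nhds hε)] with k hk s hs
      refine lt_of_le_of_lt ?_ hk
      rw [dist_comm, dist_eq_norm, ← mul_sub, norm_mul, Complex.norm_I, one_mul]
      have h1 : ⟪J k ψ, U k s⟫_ℂ - ⟪ψ, u s⟫_ℂ = ⟪J k ψ - ψ, U k s⟫_ℂ + ⟪ψ, U k s - u s⟫_ℂ := by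
        rw [inner_sub_left, inner_sub_right]; ring
      rw [h1]
      refine (norm_add_le _ _).trans (add_le_add ?_ ?_)
      · rw [← hUnorm k s]; exact norm_inner_le_norm _ _
      · refine (norm_inner_le_norm _ _).trans ?_
        gcongr
        refine (hUu k s).trans ?_
        gcongr
        rw [mem_ball_zero_iff, Real.norm_eq_abs] at hs
        exact hs.le
    exact hasDerivAt_of_tendstoUniformlyOn Metric.isOpen_ball hunif
      (Eventually.of_forall fun k s _ => hder k s)
      (fun s _ => tendsto_const_nhds.inner (hu s)) (by simp)

end Existence

/-- If `u' = iHu` is tested against `f` with `H f = λ f + r`, then `⟪f, u⟫` stays within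
`|t| ‖r‖ sup ‖u‖` of `e^{iλt} ⟪f, u(0)⟫`. -/
lemma norm_inner_ge_of_quasimode {f r : E} {lam K : ℝ} {u : ℝ → E} (hK : ∀ t, ‖u t‖ ≤ K)
    (hu : ∀ t : ℝ, HasDerivAt (fun s => ⟪f, u s⟫_ℂ) (Complex.I * ⟪(lam : ℂ) • f + r, u t⟫_ℂ) t)
    (t : ℝ) : ‖⟪f, u 0⟫_ℂ‖ - ‖r‖ * K * |t| ≤ ‖⟪f, u t⟫_ℂ‖ := by
  set w : ℝ → ℂ := fun s => Complex.exp (-(Complex.I * lam) * s) * ⟪f, u s⟫_ℂ with hw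
  have hexp : ∀ s : ℝ, ‖Complex.exp (-(Complex.I * lam) * s)‖ = 1 := fun s => by
    rw [Complex.norm_exp]; simp
  have hder : ∀ s : ℝ, HasDerivAt w (Complex.exp (-(Complex.I * lam) * s) *
      (Complex.I * ⟪r, u s⟫_ℂ)) s := by
    intro s
    have h1 : HasDerivAt (fun s : ℝ => Complex.exp (-(Complex.I * lam) * s))
        (Complex.exp (-(Complex.I * lam) * s) * -(Complex.I * lam)) s := by
      have h2 : HasDerivAt (fun s : ℝ => -(Complex.I * lam) * s) (-(Complex.I * lam)) s := by
        simpa using (Complex.ofRealCLM.hasDerivAt (x := s)).const_mul (-(Complex.I * lam))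
      exact h2.cexp
    refine (h1.mul (hu s)).congr_deriv ?_
    rw [inner_add_left, inner_smul_left, Complex.conj_ofReal]
    ring
  have hb := Convex.norm_image_sub_le_of_norm_hasDerivWithin_le
    (f := w) (C := ‖r‖ * K) (s := Set.univ) (x := 0) (y := t)
    (fun s _ => (hder s).hasDerivWithinAt) (fun s _ => by
      rw [norm_mul, hexp, one_mul, norm_mul, Complex.norm_I, one_mul]
      exact (norm_inner_le_norm _ _).trans (by gcongr; exact hK s))
      convex_univ (Set.mem_univ _) (Set.mem_univ _)
  have h0 : ‖w t‖ = ‖⟪f, u t⟫_ℂ‖ := by rw [hw]; simp only [norm_mul, hexp, one_mul]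
  have h1 : ‖w 0‖ = ‖⟪f, u 0⟫_ℂ‖ := by rw [hw]; simp only [norm_mul, hexp, one_mul]
  have h2 := norm_sub_norm_le (w 0) (w t)
  rw [norm_sub_rev, h0, h1] at h2
  rw [sub_zero, Real.norm_eq_abs] at hb
  linarith

end AbstractEvolution

/-! ### The graph of the magnetic gradient -/

section MagneticGraph

open Filter Topology

variable {n : ℕ}

lemma integral_mul_eq_inner_toLp (g : L2 n) {ψ : EuclideanSpace ℝ (Fin n) → ℂ}
    (hψ : MemLp ψ 2 volume) : ∫ x, g x * ψ x = ⟪hψ.star.toLp, g⟫_ℂ := by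
  rw [L2.inner_def]
  refine integral_congr_ae ?_
  filter_upwards [hψ.star.coeFn_toLp] with x hx
  rw [hx, RCLike.inner_apply]
  simp

/-- `A` is locally square integrable, stated as `A_j φ ∈ L²` for continuous compactly supported `φ`.
It makes the integrals in `HasMagneticGradient` converge, so that they are continuous in the
functions tested. -/
def IsLocallyL2Potential (A : EuclideanSpace ℝ (Fin n) → EuclideanSpace ℝ (Fin n)) : Prop :=
  ∀ φ : EuclideanSpace ℝ (Fin n) → ℂ, Continuous φ → HasCompactSupport φ → ∀ j : Fin n,
    MemLp (fun x => (A x j : ℂ) * φ x) 2 volume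

lemma ContDiff.continuous_fderiv_single {φ : EuclideanSpace ℝ (Fin n) → ℂ} (hφ : ContDiff ℝ ∞ φ)
    (j : Fin n) : Continuous fun x => fderiv ℝ φ x (EuclideanSpace.single j 1) :=
  (hφ.continuous_fderiv (by simp)).clm_apply continuous_const

lemma IsLocallyL2Potential.memLp {A : EuclideanSpace ℝ (Fin n) → EuclideanSpace ℝ (Fin n)}
    (hA : IsLocallyL2Potential A) {φ : EuclideanSpace ℝ (Fin n) → ℂ} (hφ : ContDiff ℝ ∞ φ)
    (hc : HasCompactSupport φ) (j : Fin n) :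
    MemLp (fun x => fderiv ℝ φ x (EuclideanSpace.single j 1) + Complex.I * (A x j : ℂ) * φ x)
      2 volume := by
  have h1 : MemLp (fun x => fderiv ℝ φ x (EuclideanSpace.single j 1)) 2 volume :=
    (hφ.continuous_fderiv_single j).memLp_of_hasCompactSupport (hc.fderiv_apply ℝ _)
  have h2 := (hA φ hφ.continuous hc j).const_mul Complex.I
  simp only [← mul_assoc] at h2
  exact h1.add h2

lemma hasMagneticGradient_iff {A : EuclideanSpace ℝ (Fin n) → EuclideanSpace ℝ (Fin n)}
    (hA : IsLocallyL2Potential A) (f : L2 n) (G : Fin n → L2 n) :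
    HasMagneticGradient A f G ↔
      ∀ (φ : EuclideanSpace ℝ (Fin n) → ℂ) (hφ : ContDiff ℝ ∞ φ) (hc : HasCompactSupport φ)
        (j : Fin n), ⟪(hφ.continuous.memLp_of_hasCompactSupport (p := 2) (μ := volume)
            hc).star.toLp, G j⟫_ℂ + ⟪(hA.memLp hφ hc j).star.toLp, f⟫_ℂ = 0 := by
  refine forall_congr' fun φ => forall_congr' fun hφ => forall_congr' fun hc =>
    forall_congr' fun j => ?_
  rw [integral_mul_eq_inner_toLp _ (hφ.continuous.memLp_of_hasCompactSupport hc),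
    integral_mul_eq_inner_toLp _ (hA.memLp hφ hc j), eq_neg_iff_add_eq_zero]

/-- The graph of `∇ - iA` on `L²`, with its maximal domain. -/
noncomputable def magneticGraph {A : EuclideanSpace ℝ (Fin n) → EuclideanSpace ℝ (Fin n)}
    (hA : IsLocallyL2Potential A) :
    Submodule ℂ (WithLp 2 (L2 n × PiLp 2 (fun _ : Fin n => L2 n))) where
  carrier := {w | HasMagneticGradient A w.fst w.snd}
  add_mem' := by
    intro v w hv hw
    simp only [Set.mem_ofPred_eq, hasMagneticGradient_iff hA] at hv hw ⊢
    intro φ hφ hc j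
    simp only [WithLp.add_fst, WithLp.add_snd, PiLp.add_apply, inner_add_right]
    linear_combination hv φ hφ hc j + hw φ hφ hc j
  zero_mem' := by
    simp only [Set.mem_ofPred_eq, hasMagneticGradient_iff hA]
    intro φ hφ hc j
    simp
  smul_mem' := by
    intro c w hw
    simp only [Set.mem_ofPred_eq, hasMagneticGradient_iff hA] at hw ⊢
    intro φ hφ hc j
    simp only [WithLp.smul_fst, WithLp.smul_snd, PiLp.smul_apply, inner_smul_right]
    linear_combination c * hw φ hφ hc j

lemma isClosed_magneticGraph {A : EuclideanSpace ℝ (Fin n) → EuclideanSpace ℝ (Fin n)}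
    (hA : IsLocallyL2Potential A) :
    IsClosed (magneticGraph hA :
      Set (WithLp 2 (L2 n × PiLp 2 (fun _ : Fin n => L2 n)))) := by
  change IsClosed {w : WithLp 2 (L2 n × PiLp 2 (fun _ : Fin n => L2 n)) |
    HasMagneticGradient A w.fst w.snd}
  simp only [hasMagneticGradient_iff hA, Set.ofPred_forall]
  refine isClosed_iInter fun φ => isClosed_iInter fun hφ => isClosed_iInter fun hc =>
    isClosed_iInter fun j => isClosed_eq ?_ continuous_const
  have h1 : Continuous fun w : WithLp 2 (L2 n × PiLp 2 (fun _ : Fin n => L2 n)) => w.fst :=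
    WithLp.continuous_fst ..
  have h2 : Continuous fun w : WithLp 2 (L2 n × PiLp 2 (fun _ : Fin n => L2 n)) => w.snd j :=
    (PiLp.continuous_apply 2 _ j).comp (WithLp.continuous_snd ..)
  exact (continuous_const.inner h2).add (continuous_const.inner h1)

lemma isMagneticHamiltonian_iff_formOperator
    {A : EuclideanSpace ℝ (Fin n) → EuclideanSpace ℝ (Fin n)}
    (hA : IsLocallyL2Potential A) (f g : L2 n) :
    IsMagneticHamiltonian A f g ↔ FormOperator (magneticGraph hA) f g := by
  constructor
  · rintro ⟨G, hG, h⟩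
    refine ⟨WithLp.toLp 2 G, hG, fun φ Φ hφ => ?_⟩
    rw [PiLp.inner_apply]
    exact h φ Φ hφ
  · rintro ⟨G, hG, h⟩
    refine ⟨G, hG, fun φ Φ hφ => ?_⟩
    have := h φ (WithLp.toLp 2 Φ) hφ
    rwa [PiLp.inner_apply] at this

end MagneticGraph

/-! ### The Hamiltonian on smooth functions supported away from the origin -/

section TestFunctions

open Filter Topology

variable {n : ℕ}

/-- Smooth compactly supported functions on `ℝⁿ ∖ {0}`. -/
structure IsPuncturedTest (f : EuclideanSpace ℝ (Fin n) → ℂ) : Prop where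
  contDiff : ContDiff ℝ ∞ f
  hasCompactSupport : HasCompactSupport f
  zero_notMem : 0 ∉ tsupport f

/-- The potential is smooth away from the origin. -/
def IsSmoothOffZero (A : EuclideanSpace ℝ (Fin n) → EuclideanSpace ℝ (Fin n)) : Prop :=
  ∀ (j : Fin n) (x : EuclideanSpace ℝ (Fin n)), x ≠ 0 → ContDiffAt ℝ ∞ (fun y => A y j) x

/-- The covariant derivative `(∂_j - iA_j) f`. -/
noncomputable def covariantDeriv (A : EuclideanSpace ℝ (Fin n) → EuclideanSpace ℝ (Fin n))
    (j : Fin n) (f : EuclideanSpace ℝ (Fin n) → ℂ) (x : EuclideanSpace ℝ (Fin n)) : ℂ :=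
  fderiv ℝ f x (EuclideanSpace.single j 1) - Complex.I * (A x j : ℂ) * f x

namespace IsPuncturedTest

variable {f : EuclideanSpace ℝ (Fin n) → ℂ}
  {A : EuclideanSpace ℝ (Fin n) → EuclideanSpace ℝ (Fin n)}

lemma continuous (hf : IsPuncturedTest f) : Continuous f := hf.contDiff.continuous

lemma memLp (hf : IsPuncturedTest f) (p : ℝ≥0∞) : MemLp f p volume :=
  hf.continuous.memLp_of_hasCompactSupport hf.hasCompactSupport

lemma of_tsupport_subset {g : EuclideanSpace ℝ (Fin n) → ℂ} (hf : IsPuncturedTest f)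
    (hg : ContDiff ℝ ∞ g) (hgf : tsupport g ⊆ tsupport f) : IsPuncturedTest g :=
  ⟨hg, hf.hasCompactSupport.of_isClosed_subset (isClosed_tsupport g) hgf,
    fun h => hf.zero_notMem (hgf h)⟩

lemma fderiv_single (hf : IsPuncturedTest f) (j : Fin n) :
    IsPuncturedTest fun x => fderiv ℝ f x (EuclideanSpace.single j 1) :=
  hf.of_tsupport_subset ((hf.contDiff.fderiv_right (m := ∞) (by simp)).clm_apply contDiff_const)
    (tsupport_fderiv_apply_subset ℝ _)

lemma potential_mul (hf : IsPuncturedTest f) (hA : IsSmoothOffZero A) (j : Fin n) :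
    IsPuncturedTest fun x => (A x j : ℂ) * f x := by
  have hsub : tsupport (fun x => (A x j : ℂ) * f x) ⊆ tsupport f :=
    closure_mono (Function.support_mul_subset_right _ _)
  refine hf.of_tsupport_subset (contDiff_iff_contDiffAt.2 fun x => ?_) hsub
  by_cases hx : x ∈ tsupport f
  · have hx0 : x ≠ 0 := fun h => hf.zero_notMem (h ▸ hx)
    exact (Complex.ofRealCLM.contDiff.contDiffAt.comp x (hA j x hx0)).mul hf.contDiff.contDiffAt
  · have : (fun x => (A x j : ℂ) * f x) =ᶠ[𝓝 x] fun _ => 0 :=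
      (notMem_tsupport_iff_eventuallyEq.1 fun h => hx (hsub h))
    exact contDiffAt_const.congr_of_eventuallyEq this

lemma sub {g : EuclideanSpace ℝ (Fin n) → ℂ} (hf : IsPuncturedTest f) (hg : IsPuncturedTest g) :
    IsPuncturedTest fun x => f x - g x :=
  ⟨hf.contDiff.sub hg.contDiff, hf.hasCompactSupport.sub hg.hasCompactSupport,
    fun h => ((tsupport_sub f g) h).elim hf.zero_notMem hg.zero_notMem⟩

lemma const_mul (hf : IsPuncturedTest f) (c : ℂ) : IsPuncturedTest fun x => c * f x :=
  hf.of_tsupport_subset (contDiff_const.mul hf.contDiff)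
    (closure_mono (Function.support_mul_subset_right _ _))

lemma star (hf : IsPuncturedTest f) : IsPuncturedTest fun x => star (f x) :=
  hf.of_tsupport_subset (Complex.conjCLE.contDiff.comp hf.contDiff)
    (closure_mono fun x hx => by simpa using hx)

lemma covariantDeriv (hf : IsPuncturedTest f) (hA : IsSmoothOffZero A) (j : Fin n) :
    IsPuncturedTest (covariantDeriv A j f) := by
  have := (hf.fderiv_single j).sub ((hf.potential_mul hA j).const_mul Complex.I)
  simp only [← mul_assoc] at this
  exact this

lemma mul_continuous (hf : IsPuncturedTest f) {g : EuclideanSpace ℝ (Fin n) → ℂ}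
    (hg : Continuous g) : Integrable fun x => f x * g x :=
  (hf.continuous.mul hg).integrable_of_hasCompactSupport hf.hasCompactSupport.mul_right

lemma hasMagneticGradient (hf : IsPuncturedTest f) (hA : IsSmoothOffZero A) :
    HasMagneticGradient A (hf.memLp 2).toLp
      fun j => ((hf.covariantDeriv hA j).memLp 2).toLp := by
  intro φ hφ _ j
  have h1 : ∫ x, ((hf.covariantDeriv hA j).memLp 2).toLp _ x * φ x =
      ∫ x, (fderiv ℝ f x (EuclideanSpace.single j 1) * φ x -
        Complex.I * (((A x j : ℂ) * f x) * φ x)) := by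
    refine integral_congr_ae ?_
    filter_upwards [((hf.covariantDeriv hA j).memLp 2).coeFn_toLp] with x hx
    rw [hx, _root_.covariantDeriv]; ring
  have h2 : ∫ x, (hf.memLp 2).toLp _ x *
      (fderiv ℝ φ x (EuclideanSpace.single j 1) + Complex.I * (A x j : ℂ) * φ x) =
      ∫ x, (f x * fderiv ℝ φ x (EuclideanSpace.single j 1) +
        Complex.I * (((A x j : ℂ) * f x) * φ x)) := by
    refine integral_congr_ae ?_
    filter_upwards [(hf.memLp 2).coeFn_toLp] with x hx
    rw [hx]; ring
  have i1 := (hf.fderiv_single j).mul_continuous hφ.continuous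
  have i2 := hf.mul_continuous (hφ.continuous_fderiv_single j)
  have i3 := ((hf.potential_mul hA j).mul_continuous hφ.continuous).const_mul Complex.I
  rw [h1, h2, integral_sub i1 i3, integral_add i2 i3,
    integral_mul_fderiv_eq_neg_fderiv_mul_of_integrable i1 i2
      (hf.mul_continuous hφ.continuous)
      (fun x _ => (hf.contDiff.differentiable (by simp)).differentiableAt)
      (fun x _ => (hφ.differentiable (by simp)).differentiableAt)]
  ring

lemma fderiv_star_apply (hf : IsPuncturedTest f) (x v : EuclideanSpace ℝ (Fin n)) :
    fderiv ℝ (fun x => Star.star (f x)) x v = Star.star (fderiv ℝ f x v) := by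
  have h := Complex.conjCLE.toContinuousLinearMap.hasFDerivAt.comp x
    (hf.contDiff.differentiable (by simp)).differentiableAt.hasFDerivAt
  have h' : HasFDerivAt (fun x => Star.star (f x))
    (Complex.conjCLE.toContinuousLinearMap ∘L fderiv ℝ f x) x := h
  rw [h'.fderiv]
  rfl

/-- `⟪Φ_j, g⟫ = ⟪φ, -(∂_j - iA_j) g⟫` if `Φ = (∇ - iA) φ` and `g` is a test function. -/
lemma inner_gradient (hf : IsPuncturedTest f) (hA : IsSmoothOffZero A) (j : Fin n)
    {φ : L2 n} {Φ : Fin n → L2 n} (h : HasMagneticGradient A φ Φ) :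
    ⟪Φ j, (hf.memLp 2).toLp⟫_ℂ = -⟪φ, ((hf.covariantDeriv hA j).memLp 2).toLp⟫_ℂ := by
  have h1 := h _ hf.star.contDiff hf.star.hasCompactSupport j
  rw [← inner_conj_symm, ← inner_conj_symm φ, L2.inner_def, L2.inner_def, ← map_neg]
  congr 1
  refine Eq.trans ?_ (h1.trans ?_)
  · refine integral_congr_ae ?_
    filter_upwards [(hf.memLp 2).coeFn_toLp] with x hx
    rw [hx, RCLike.inner_apply]; rfl
  · congr 1
    refine integral_congr_ae ?_
    filter_upwards [((hf.covariantDeriv hA j).memLp 2).coeFn_toLp] with x hx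
    rw [hx, RCLike.inner_apply, hf.fderiv_star_apply, _root_.covariantDeriv]
    simp

lemma isMagneticHamiltonian (hf : IsPuncturedTest f) (hA : IsSmoothOffZero A)
    {h : EuclideanSpace ℝ (Fin n) → ℂ} (hh : MemLp h 2 volume)
    (hfh : ∀ x, h x = -∑ j, _root_.covariantDeriv A j (_root_.covariantDeriv A j f) x) :
    IsMagneticHamiltonian A (hf.memLp 2).toLp hh.toLp := by
  refine ⟨_, hf.hasMagneticGradient hA, fun φ Φ hφ => ?_⟩
  simp only [(hf.covariantDeriv hA _).inner_gradient hA _ hφ]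
  rw [Finset.sum_neg_distrib, ← inner_sum, ← inner_neg_right]
  congr 1
  refine Lp.ext ?_
  have h1 : ∀ j, ∀ᵐ x, (((hf.covariantDeriv hA j).covariantDeriv hA j).memLp 2).toLp _ x =
      _root_.covariantDeriv A j (_root_.covariantDeriv A j f) x := fun j => MemLp.coeFn_toLp _
  filter_upwards [hh.coeFn_toLp, Lp.coeFn_neg (∑ j,
    (((hf.covariantDeriv hA j).covariantDeriv hA j).memLp 2).toLp),
    Lp.coeFn_finsetSum (p := 2) (μ := volume) Finset.univ fun j =>
      (((hf.covariantDeriv hA j).covariantDeriv hA j).memLp 2).toLp, ae_all_iff.2 h1]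
    with x hx1 hx2 hx3 hx4
  rw [hx1, hx2, Pi.neg_apply, hx3, hfh, Finset.sum_apply]
  simp only [hx4]

end IsPuncturedTest

/-- The form domain is dense in `L²`. -/
lemma eq_zero_of_forall_magneticGradient [NeZero n]
    {A : EuclideanSpace ℝ (Fin n) → EuclideanSpace ℝ (Fin n)} (hA : IsSmoothOffZero A) (g : L2 n)
    (hg : ∀ (φ : L2 n) (Φ : Fin n → L2 n), HasMagneticGradient A φ Φ → ⟪φ, g⟫_ℂ = 0) :
    g = 0 := by
  have hloc : LocallyIntegrable g volume := (Lp.memLp g).locallyIntegrable (by norm_num)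
  have h1 := isOpen_compl_singleton.ae_eq_zero_of_integral_contDiff_smul_eq_zero
    (U := {(0 : EuclideanSpace ℝ (Fin n))}ᶜ) (hloc.locallyIntegrableOn _) (fun η hη hc hs => by
      have ht : IsPuncturedTest fun x => (η x : ℂ) := by
        have hsub : tsupport (fun x => (η x : ℂ)) ⊆ tsupport η :=
          closure_mono fun x hx => by simpa using hx
        exact ⟨Complex.ofRealCLM.contDiff.comp hη,
          hc.of_isClosed_subset (isClosed_tsupport _) hsub,
          fun h => hs (hsub h) rfl⟩
      rw [← hg _ _ (ht.hasMagneticGradient hA), L2.inner_def]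
      refine integral_congr_ae ?_
      filter_upwards [(ht.memLp 2).coeFn_toLp] with x hx
      rw [hx, RCLike.inner_apply]
      simp [mul_comm])
  refine Lp.ext ?_
  filter_upwards [h1, Lp.coeFn_zero ℂ 2 (volume : Measure (EuclideanSpace ℝ (Fin n))),
    compl_mem_ae_iff.2 (measure_singleton (0 : EuclideanSpace ℝ (Fin n)))] with x hx1 hx2 hx3
  rw [hx1 hx3, hx2]; rfl

end TestFunctions

/-! ### The magnetic potential -/

section Potential

open Filter Topology

variable {n : ℕ}

/-- The involution of the coordinates with `(M x)_i = ± x_{magneticSwap i}`: it exchanges `2b` and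
`2b + 1`, and fixes the last coordinate. -/
def magneticSwap (n : ℕ) (i : Fin n) : Fin n :=
  if h : (i : ℕ) < n - 1 then
    if (i : ℕ) % 2 = 0 then ⟨i + 1, by omega⟩ else ⟨i - 1, by omega⟩
  else i

/-- The sign in `(M x)_i = ± x_{magneticSwap i}`, and `0` for the last coordinate. -/
def magneticSign (n : ℕ) (i : Fin n) : ℝ :=
  if (i : ℕ) < n - 1 then if (i : ℕ) % 2 = 0 then 1 else -1 else 0

lemma magneticSwap_involutive (hodd : Odd n) : Function.Involutive (magneticSwap n) := by
  intro i
  obtain ⟨m, rfl⟩ := hodd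
  ext
  unfold magneticSwap
  split_ifs <;> simp_all <;> omega

lemma magneticSign_swap (hodd : Odd n) (i : Fin n) :
    magneticSign n (magneticSwap n i) = -magneticSign n i := by
  obtain ⟨m, rfl⟩ := hodd
  unfold magneticSwap magneticSign
  split_ifs <;> simp_all <;> omega

lemma magneticMatrix_apply (hodd : Odd n) (i j : Fin n) :
    magneticMatrix n i j = if j = magneticSwap n i then magneticSign n i else 0 := by
  obtain ⟨m, rfl⟩ := hodd
  have hi := i.2
  have hj := j.2
  unfold magneticMatrix omegaMatrix magneticSwap magneticSign sigmaMatrix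
  simp only [Matrix.of_apply, Fin.ext_iff]
  rcases Nat.mod_two_eq_zero_or_one i with h1 | h1 <;>
  rcases Nat.mod_two_eq_zero_or_one j with h2 | h2 <;>
  · have e1 : Fin.ofNat 2 (i : ℕ) = ⟨(i : ℕ) % 2, by omega⟩ := rfl
    have e2 : Fin.ofNat 2 (j : ℕ) = ⟨(j : ℕ) % 2, by omega⟩ := rfl
    simp only [e1, e2, h1, h2]
    split_ifs <;> (try dsimp only at *) <;> first | contradiction | (exfalso; omega) | simp

lemma magneticPotential_apply (hodd : Odd n) (α : ℝ) (x : EuclideanSpace ℝ (Fin n)) (j : Fin n) :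
    magneticPotential n α x j = ‖x‖ ^ (-α) * (magneticSign n j * x (magneticSwap n j)) := by
  simp only [magneticPotential, Pi.smul_apply, smul_eq_mul]
  congr 1
  simp [Matrix.mulVec, dotProduct, magneticMatrix_apply hodd]

lemma abs_magneticSign_le (j : Fin n) : |magneticSign n j| ≤ 1 := by
  unfold magneticSign; split_ifs <;> simp

lemma magneticSign_mul_apply_single (j : Fin n) :
    magneticSign n j * (EuclideanSpace.single j (1 : ℝ) : EuclideanSpace ℝ (Fin n))
      (magneticSwap n j) = 0 := by
  by_cases h : (j : ℕ) < n - 1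
  · have : magneticSwap n j ≠ j := by
      unfold magneticSwap
      split_ifs with h1
      · simp [Fin.ext_iff]
      · simp only [ne_eq, Fin.ext_iff]; omega
    simp [this]
  · simp [magneticSign, h]

lemma sum_magneticSign_mul_self (hodd : Odd n) (x : EuclideanSpace ℝ (Fin n)) :
    ∑ j, magneticSign n j * x (magneticSwap n j) * x j = 0 := by
  set e : Equiv.Perm (Fin n) := (magneticSwap_involutive hodd).toPerm
  have h := Equiv.sum_comp e fun j => magneticSign n j * x (magneticSwap n j) * x j
  have h2 : ∀ j, magneticSign n (e j) * x (magneticSwap n (e j)) * x (e j) =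
      -(magneticSign n j * x (magneticSwap n j) * x j) := by
    intro j
    change magneticSign n (magneticSwap n j) * x (magneticSwap n (magneticSwap n j)) *
      x (magneticSwap n j) = _
    rw [magneticSign_swap hodd, magneticSwap_involutive hodd j]
    ring
  simp only [h2, Finset.sum_neg_distrib] at h
  linarith

lemma magneticSign_last {l : Fin n} (hl : (l : ℕ) = n - 1) : magneticSign n l = 0 := by
  simp [magneticSign, hl]

lemma sum_sq_magneticSign_mul (hodd : Odd n) {l : Fin n} (hl : (l : ℕ) = n - 1)
    (x : EuclideanSpace ℝ (Fin n)) :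
    ∑ j, (magneticSign n j * x (magneticSwap n j)) ^ 2 = ‖x‖ ^ 2 - x l ^ 2 := by
  set e : Equiv.Perm (Fin n) := (magneticSwap_involutive hodd).toPerm
  have hel : magneticSwap n l = l := by simp [magneticSwap, hl]
  have h1 : ∀ j, (magneticSign n j * x (magneticSwap n j)) ^ 2 =
      (fun j => x j ^ 2 - if j = l then x l ^ 2 else 0) (e j) := by
    intro j
    change _ = x (magneticSwap n j) ^ 2 - if magneticSwap n j = l then x l ^ 2 else 0
    have h2 : magneticSwap n j = l ↔ j = l := by
      constructor
      · intro h; rw [← magneticSwap_involutive hodd j, h, hel]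
      · rintro rfl; exact hel
    by_cases hj : j = l
    · subst hj; simp [magneticSign_last hl, hel]
    · have h3 : (j : ℕ) < n - 1 := by
        have := j.2
        have : (j : ℕ) ≠ l := fun h => hj (Fin.ext h)
        omega
      rw [if_neg (by rwa [h2]), sub_zero, mul_pow]
      have : magneticSign n j ^ 2 = 1 := by
        unfold magneticSign; split_ifs <;> simp
      rw [this, one_mul]
  simp only [h1]
  rw [Equiv.sum_comp e fun j => x j ^ 2 - if j = l then x l ^ 2 else 0, Finset.sum_sub_distrib,
    EuclideanSpace.real_norm_sq_eq]
  simp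

lemma abs_magneticPotential_le (hodd : Odd n) (α : ℝ) (x : EuclideanSpace ℝ (Fin n)) (j : Fin n) :
    |magneticPotential n α x j| ≤ ‖x‖ ^ (-α) * ‖x‖ := by
  rw [magneticPotential_apply hodd, abs_mul, abs_of_nonneg (by positivity), abs_mul]
  have h1 : |x (magneticSwap n j)| ≤ ‖x‖ := PiLp.norm_apply_le x _
  have h2 := abs_magneticSign_le j
  gcongr
  nlinarith [abs_nonneg (x (magneticSwap n j)), abs_nonneg (magneticSign n j)]

lemma isSmoothOffZero_magneticPotential (hodd : Odd n) (α : ℝ) :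
    IsSmoothOffZero (magneticPotential n α) := by
  intro j x hx
  simp only [magneticPotential_apply hodd]
  have h1 : ContDiffAt ℝ ∞ (fun y : EuclideanSpace ℝ (Fin n) => ‖y‖ ^ (-α)) x :=
    (contDiffAt_norm ℝ hx).rpow_const_of_ne (norm_ne_zero_iff.2 hx)
  have h2 : ContDiffAt ℝ ∞ (fun y : EuclideanSpace ℝ (Fin n) => y (magneticSwap n j)) x :=
    (EuclideanSpace.proj (𝕜 := ℝ) (magneticSwap n j)).contDiff.contDiffAt
  exact h1.mul (contDiffAt_const.mul h2)

/-- `|A| ≤ |x|^{1 - α}` is square integrable near the origin, since `2 α - 2 < n`. -/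
lemma isLocallyL2Potential_magneticPotential (hn : 3 ≤ n) (hodd : Odd n) {α : ℝ} (hα : α < 2) :
    IsLocallyL2Potential (magneticPotential n α) := by
  intro φ hφ hc j
  have : NeZero n := ⟨by omega⟩
  have hmeas : Measurable fun x : EuclideanSpace ℝ (Fin n) => magneticPotential n α x j := by
    simp only [magneticPotential_apply hodd]
    have : Measurable fun x : EuclideanSpace ℝ (Fin n) => x (magneticSwap n j) :=
      (EuclideanSpace.proj (𝕜 := ℝ) (magneticSwap n j)).continuous.measurable
    exact (measurable_norm.pow_const _).mul (measurable_const.mul this)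
  have hm : AEStronglyMeasurable (fun x => (magneticPotential n α x j : ℂ) * φ x) volume :=
    ((Complex.measurable_ofReal.comp hmeas).mul hφ.measurable).aestronglyMeasurable
  rw [memLp_two_iff_integrable_sq_norm hm]
  obtain ⟨C, hC⟩ := hφ.bounded_above_of_compact_support hc
  obtain ⟨r, hr0, hr⟩ := hc.isCompact.isBounded.subset_closedBall_lt 0 0
  set F : ℝ → ℝ := fun s => Set.indicator (Set.Iic r) (fun s => C ^ 2 * (s ^ (-α) * s) ^ 2) s
  have hF : Integrable fun x : EuclideanSpace ℝ (Fin n) => F ‖x‖ := by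
    rw [integrable_fun_norm_addHaar]
    have h1 : IntegrableOn (fun s : ℝ => C ^ 2 * s ^ ((n : ℝ) + 1 - 2 * α)) (Set.Ioc 0 r) := by
      have hn' : (3 : ℝ) ≤ n := by exact_mod_cast hn
      have := intervalIntegral.intervalIntegrable_rpow' (a := 0) (b := r)
        (r := (n : ℝ) + 1 - 2 * α) (by linarith)
      exact ((intervalIntegrable_iff_integrableOn_Ioc_of_le hr0.le).1 this).const_mul _
    have h2 := (integrable_indicator_iff measurableSet_Ioc).2 h1
    refine h2.integrableOn.congr_fun (fun s hs => ?_) measurableSet_Ioi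
    have hs0 : 0 < s := hs
    simp only [F, Set.indicator, Set.mem_Ioc, Set.mem_Iic, hs0, true_and, smul_eq_mul]
    split_ifs with h
    · rw [finrank_euclideanSpace_fin, mul_pow, ← Real.rpow_natCast s (n - 1),
        ← Real.rpow_mul_natCast hs0.le, ← Real.rpow_natCast s 2, Nat.cast_sub (by omega),
        ← Real.rpow_add hs0, mul_left_comm, ← Real.rpow_add hs0]
      congr 2
      push_cast; ring
    · simp
  refine hF.mono' (hm.norm.pow 2) (Eventually.of_forall fun x => ?_)
  rw [Real.norm_of_nonneg (by positivity), norm_mul, mul_pow, Complex.norm_real, Real.norm_eq_abs]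
  by_cases hx : x ∈ tsupport φ
  · have hxr : ‖x‖ ≤ r := by simpa using hr hx
    simp only [F, Set.indicator, Set.mem_Iic, hxr, if_true]
    rw [mul_comm]
    have := abs_magneticPotential_le hodd α x j
    have := hC x
    gcongr
  · rw [image_eq_zero_of_notMem_tsupport hx]
    simp only [norm_zero, F]
    rw [zero_pow two_ne_zero, mul_zero]
    exact Set.indicator_nonneg (fun s _ => by positivity) _

end Potential

/-! ### The Hamiltonian on axially symmetric functions -/

section AxialFunctions

open Filter Topology

variable {n : ℕ}

/-- `∇v(x) = β x + γ e_l`: the form of the gradient of a function of `|x|` and `x_l`. -/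
def HasAxialGradientAt (l : Fin n) (v : EuclideanSpace ℝ (Fin n) → ℝ) (β γ : ℝ)
    (x : EuclideanSpace ℝ (Fin n)) : Prop :=
  HasFDerivAt v (β • innerSL ℝ x + γ • EuclideanSpace.proj (𝕜 := ℝ) l) x

namespace HasAxialGradientAt

variable {l : Fin n} {v w : EuclideanSpace ℝ (Fin n) → ℝ} {β γ β' γ' : ℝ}
  {x : EuclideanSpace ℝ (Fin n)}

lemma norm_sq : HasAxialGradientAt l (fun x => ‖x‖ ^ 2) 2 0 x := by
  have h := (hasStrictFDerivAt_norm_sq x).hasFDerivAt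
  refine h.congr_fderiv ?_
  ext y; simp

lemma coord : HasAxialGradientAt l (fun x => x l) 0 1 x := by
  have h := (EuclideanSpace.proj (𝕜 := ℝ) l).hasFDerivAt (x := x)
  refine h.congr_fderiv ?_
  ext y; simp

lemma const (c : ℝ) : HasAxialGradientAt l (fun _ => c) 0 0 x := by
  refine (hasFDerivAt_const c x).congr_fderiv ?_
  ext y; simp

lemma congr_coeff (h : HasAxialGradientAt l v β γ x) (hβ : β = β') (hγ : γ = γ') :
    HasAxialGradientAt l v β' γ' x := by subst hβ hγ; exact h

lemma add (hv : HasAxialGradientAt l v β γ x) (hw : HasAxialGradientAt l w β' γ' x) :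
    HasAxialGradientAt l (fun x => v x + w x) (β + β') (γ + γ') x := by
  refine (HasFDerivAt.add hv hw).congr_fderiv ?_
  ext y; simp; ring

lemma mul (hv : HasAxialGradientAt l v β γ x) (hw : HasAxialGradientAt l w β' γ' x) :
    HasAxialGradientAt l (fun x => v x * w x) (v x * β' + w x * β) (v x * γ' + w x * γ) x := by
  refine (HasFDerivAt.mul hv hw).congr_fderiv ?_
  ext y; simp; ring

lemma comp {g : ℝ → ℝ} {g' : ℝ} (hv : HasAxialGradientAt l v β γ x) (hg : HasDerivAt g g' (v x)) :
    HasAxialGradientAt l (fun x => g (v x)) (g' * β) (g' * γ) x := by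
  refine (HasDerivAt.comp_hasFDerivAt x hg hv).congr_fderiv ?_
  ext y; simp; ring

lemma fderiv_ofReal_single (hv : HasAxialGradientAt l v β γ x) (j : Fin n) :
    fderiv ℝ (fun x => (v x : ℂ)) x (EuclideanSpace.single j 1) =
      ((β * x j + γ * if j = l then 1 else 0 : ℝ) : ℂ) := by
  have h : HasFDerivAt (fun x => (v x : ℂ)) _ x := Complex.ofRealCLM.hasFDerivAt.comp x hv
  rw [h.fderiv]
  by_cases hj : j = l
  · subst hj; simp [EuclideanSpace.inner_single_right]
  · simp [EuclideanSpace.inner_single_right, hj, Ne.symm hj]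

end HasAxialGradientAt

/-- For an axially symmetric `v`, `A · ∇v` and `div (A v)` vanish, so that
`(∇ - iA)² v = Δv - |A|² v`. -/
lemma sum_covariantDeriv_covariantDeriv (hodd : Odd n) (α : ℝ) {l : Fin n} (hl : (l : ℕ) = n - 1)
    {v β γ β₁ γ₁ β₂ γ₂ : EuclideanSpace ℝ (Fin n) → ℝ}
    (hv : ∀ x, HasAxialGradientAt l v (β x) (γ x) x)
    (hβ : ∀ x, HasAxialGradientAt l β (β₁ x) (γ₁ x) x)
    (hγ : ∀ x, HasAxialGradientAt l γ (β₂ x) (γ₂ x) x)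
    (h0 : 0 ∉ tsupport v) (x : EuclideanSpace ℝ (Fin n)) :
    ∑ j, covariantDeriv (magneticPotential n α) j
      (covariantDeriv (magneticPotential n α) j fun x => (v x : ℂ)) x =
      ((β₁ x * ‖x‖ ^ 2 + γ₁ x * x l + n * β x + β₂ x * x l + γ₂ x -
        (‖x‖ ^ (-α)) ^ 2 * (‖x‖ ^ 2 - x l ^ 2) * v x : ℝ) : ℂ) := by
  set h : EuclideanSpace ℝ (Fin n) → ℝ := fun x => ‖x‖ ^ (-α) * v x with hh
  -- `h` is axially symmetric as well; at the origin, where `|x|^{-α}` is singular, `v` vanishes.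
  obtain ⟨μ, ν, hμν⟩ : ∃ μ ν, HasAxialGradientAt l h μ ν x := by
    by_cases hx : x = 0
    · have h1 : v =ᶠ[𝓝 x] 0 := by
        rw [hx]; exact notMem_tsupport_iff_eventuallyEq.1 h0
      have h2 : h =ᶠ[𝓝 x] fun _ => 0 := by
        filter_upwards [h1] with y hy
        simp [hh, hy]
      exact ⟨0, 0, (HasAxialGradientAt.const 0).congr_of_eventuallyEq h2⟩
    · have hx' : ‖x‖ ^ 2 ≠ 0 := by simpa using hx
      have h1 : h = fun x => (‖x‖ ^ 2) ^ (-α / 2) * v x := by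
        funext y
        have e : 2 * (-α / 2) = -α := by ring
        rw [hh, ← Real.rpow_natCast, ← Real.rpow_mul (norm_nonneg y), Nat.cast_ofNat, e]
      have h2 := (HasAxialGradientAt.norm_sq (l := l)).comp
        (Real.hasDerivAt_rpow_const (p := -α / 2) (Or.inl hx'))
      rw [h1]
      exact ⟨_, _, h2.mul (hv x)⟩
  set m : Fin n → EuclideanSpace ℝ (Fin n) → ℝ := fun j x =>
    magneticSign n j * x (magneticSwap n j) with hm
  have hmd : ∀ j, HasFDerivAt (m j)
      (magneticSign n j • EuclideanSpace.proj (𝕜 := ℝ) (magneticSwap n j)) x := fun j =>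
    (EuclideanSpace.proj (𝕜 := ℝ) (magneticSwap n j)).hasFDerivAt.const_mul _
  have hD : ∀ j, covariantDeriv (magneticPotential n α) j (fun x => (v x : ℂ)) = fun y =>
      ((β y * y j + γ y * (if j = l then 1 else 0) : ℝ) : ℂ) -
        Complex.I * ((m j y * h y : ℝ) : ℂ) := by
    intro j
    funext y
    rw [covariantDeriv, (hv y).fderiv_ofReal_single, magneticPotential_apply hodd]
    simp only [hm, hh]
    push_cast
    ring
  -- The real part sums to `Δv - |A|² v`, the imaginary part to `-(div (A v) + A · ∇v)`.
  have hDD : ∀ j, covariantDeriv (magneticPotential n α) j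
      (covariantDeriv (magneticPotential n α) j fun x => (v x : ℂ)) x =
      (((β₁ x * x j + γ₁ x * if j = l then 1 else 0) * x j + β x +
        (β₂ x * x j + γ₂ x * if j = l then 1 else 0) * (if j = l then 1 else 0) -
        (‖x‖ ^ (-α)) ^ 2 * (m j x) ^ 2 * v x : ℝ) : ℂ) - Complex.I *
        ((m j x * (μ * x j + ν * if j = l then 1 else 0) + h x * (magneticSign n j *
          (EuclideanSpace.single j (1 : ℝ) : EuclideanSpace ℝ (Fin n)) (magneticSwap n j)) +
          ‖x‖ ^ (-α) * m j x * (β x * x j + γ x * if j = l then 1 else 0) : ℝ) : ℂ) := by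
    intro j
    have d1 := (HasFDerivAt.mul (hβ x) ((EuclideanSpace.proj (𝕜 := ℝ) j).hasFDerivAt (x := x))).add
      (HasFDerivAt.mul_const (hγ x) (if j = l then (1 : ℝ) else 0))
    have d2 := (hmd j).mul hμν
    have d3 := (Complex.ofRealCLM.hasFDerivAt.comp x d1).sub
      ((Complex.ofRealCLM.hasFDerivAt.comp x d2).const_mul Complex.I)
    rw [hD j, covariantDeriv]
    have d4 : HasFDerivAt (fun y => ((β y * y j + γ y * (if j = l then 1 else 0) : ℝ) : ℂ) -
        Complex.I * ((m j y * h y : ℝ) : ℂ)) _ x := d3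
    rw [d4.fderiv, magneticPotential_apply hodd]
    have e0 : ∀ (i : Fin n) (y : EuclideanSpace ℝ (Fin n)),
        EuclideanSpace.proj (𝕜 := ℝ) i y = y i := fun _ _ => rfl
    have e1 : (EuclideanSpace.single j (1 : ℝ) : EuclideanSpace ℝ (Fin n)) j = 1 := by simp
    have e2 : (EuclideanSpace.single j (1 : ℝ) : EuclideanSpace ℝ (Fin n)) l =
        if j = l then 1 else 0 := by simp [eq_comm]
    simp only [hm, hh, sub_apply, ContinuousLinearMap.comp_apply, smul_apply, add_apply,
      smul_eq_mul, Complex.ofRealCLM_apply, innerSL_apply_apply, e0, e1, e2,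
      EuclideanSpace.inner_single_right, conj_trivial]
    push_cast
    linear_combination ((‖x‖ ^ (-α) : ℝ) ^ 2 *
      ((magneticSign n j : ℂ) * x (magneticSwap n j)) ^ 2 * v x) * Complex.I_sq
  have hml : m l x = 0 := by simp [hm, magneticSign_last hl]
  have hmx : ∑ j, m j x * x j = 0 := sum_magneticSign_mul_self hodd x
  have hmm : ∑ j, (m j x) ^ 2 = ‖x‖ ^ 2 - x l ^ 2 := sum_sq_magneticSign_mul hodd hl x
  have hxx : ∑ j, x j ^ 2 = ‖x‖ ^ 2 := (EuclideanSpace.real_norm_sq_eq x).symm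
  rw [Finset.sum_congr rfl fun j _ => hDD j, Finset.sum_sub_distrib, ← Finset.mul_sum,
    ← Complex.ofReal_sum, ← Complex.ofReal_sum]
  have s2 : ∑ j, (m j x * (μ * x j + ν * if j = l then 1 else 0) + h x * (magneticSign n j *
          (EuclideanSpace.single j (1 : ℝ) : EuclideanSpace ℝ (Fin n)) (magneticSwap n j)) +
          ‖x‖ ^ (-α) * m j x * (β x * x j + γ x * if j = l then 1 else 0)) = 0 := by
    have : ∀ j, (m j x * (μ * x j + ν * if j = l then 1 else 0) + h x * (magneticSign n j *
          (EuclideanSpace.single j (1 : ℝ) : EuclideanSpace ℝ (Fin n)) (magneticSwap n j)) +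
          ‖x‖ ^ (-α) * m j x * (β x * x j + γ x * if j = l then 1 else 0)) =
          (μ + ‖x‖ ^ (-α) * β x) * (m j x * x j) := by
      intro j
      rw [magneticSign_mul_apply_single]
      by_cases hj : j = l
      · subst hj; rw [hml]; ring
      · rw [if_neg hj]; ring
    rw [Finset.sum_congr rfl fun j _ => this j, ← Finset.mul_sum, hmx, mul_zero]
  have s1 : ∑ j, ((β₁ x * x j + γ₁ x * if j = l then 1 else 0) * x j + β x +
        (β₂ x * x j + γ₂ x * if j = l then 1 else 0) * (if j = l then 1 else 0) -
        (‖x‖ ^ (-α)) ^ 2 * (m j x) ^ 2 * v x) = β₁ x * ‖x‖ ^ 2 + γ₁ x * x l + n * β x +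
        β₂ x * x l + γ₂ x - (‖x‖ ^ (-α)) ^ 2 * (‖x‖ ^ 2 - x l ^ 2) * v x := by
    have : ∀ j, ((β₁ x * x j + γ₁ x * if j = l then 1 else 0) * x j + β x +
        (β₂ x * x j + γ₂ x * if j = l then 1 else 0) * (if j = l then 1 else 0) -
        (‖x‖ ^ (-α)) ^ 2 * (m j x) ^ 2 * v x) = β₁ x * x j ^ 2 +
        (if j = l then γ₁ x * x j + β₂ x * x j + γ₂ x else 0) + β x -
        (‖x‖ ^ (-α)) ^ 2 * v x * (m j x) ^ 2 := by
      intro j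
      split_ifs <;> ring
    rw [Finset.sum_congr rfl fun j _ => this j, Finset.sum_sub_distrib, Finset.sum_add_distrib,
      Finset.sum_add_distrib, ← Finset.mul_sum, ← Finset.mul_sum, hmm, hxx, Finset.sum_ite_eq',
      Finset.sum_const, Finset.card_univ, Fintype.card_fin, nsmul_eq_mul]
    simp only [Finset.mem_univ, if_true]
    ring
  rw [s1, s2]
  simp

end AxialFunctions

/-! ### The quasimode -/

section Quasimode

open Filter Topology

variable {n : ℕ}

/-- A smooth cutoff to `|s| ≤ 1`, with the derivatives up to order two bounded by `K`. -/
structure IsCutoff (χ : ℝ → ℝ) (K : ℝ) : Prop where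
  contDiff : ContDiff ℝ ∞ χ
  eq_one : ∀ s, |s| ≤ 1 / 2 → χ s = 1
  nonneg : ∀ s, 0 ≤ χ s
  le_one : ∀ s, χ s ≤ 1
  eq_zero : ∀ s, 1 < s → χ s = 0
  deriv_eq_zero : ∀ s, 1 < s → deriv χ s = 0
  deriv_deriv_eq_zero : ∀ s, 1 < s → deriv (deriv χ) s = 0
  deriv_le : ∀ s, |deriv χ s| ≤ K
  deriv_deriv_le : ∀ s, |deriv (deriv χ) s| ≤ K

lemma exists_isCutoff : ∃ (χ : ℝ → ℝ) (K : ℝ), IsCutoff χ K := by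
  let χ : ContDiffBump (0 : ℝ) := ⟨1 / 2, 1, by norm_num, by norm_num⟩
  have hχ : ContDiff ℝ ∞ χ := χ.contDiff
  have hc : HasCompactSupport χ := χ.hasCompactSupport
  have h1 : ContDiff ℝ ∞ (deriv χ) := (contDiff_infty_iff_deriv.1 hχ).2
  have h2 : ContDiff ℝ ∞ (deriv (deriv χ)) := (contDiff_infty_iff_deriv.1 h1).2
  obtain ⟨K₁, hK₁⟩ := h1.continuous.bounded_above_of_compact_support hc.deriv
  obtain ⟨K₂, hK₂⟩ := h2.continuous.bounded_above_of_compact_support hc.deriv.deriv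
  have hs : ∀ s, 1 < s → s ∉ tsupport χ := by
    intro s hs
    rw [χ.tsupport_eq, Metric.mem_closedBall, dist_zero_right, Real.norm_eq_abs]
    have := le_abs_self s
    change ¬ |s| ≤ 1
    linarith
  have hs1 : tsupport (deriv χ) ⊆ tsupport χ := tsupport_deriv_subset
  have hs2 : tsupport (deriv (deriv χ)) ⊆ tsupport χ := (tsupport_deriv_subset).trans hs1
  refine ⟨χ, max K₁ K₂, hχ, fun s h => ?_, fun s => χ.nonneg, fun s => χ.le_one,
    fun s h => image_eq_zero_of_notMem_tsupport (hs s h),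
    fun s h => image_eq_zero_of_notMem_tsupport fun h' => hs s h (hs1 h'),
    fun s h => image_eq_zero_of_notMem_tsupport fun h' => hs s h (hs2 h'),
    fun s => (hK₁ s).trans (le_max_left _ _), fun s => (hK₂ s).trans (le_max_right _ _)⟩
  refine χ.one_of_mem_closedBall ?_
  rw [Metric.mem_closedBall, dist_zero_right]
  exact h

/-- The quasimode: the ground state `exp(-b|y|²/2)` of the harmonic oscillator in the variables
`y` orthogonal to the axis, cut off to the ball of radius `L` about the point `R e_l` of the
axis. -/
noncomputable def quasimode (χ : ℝ → ℝ) (l : Fin n) (b R L : ℝ) (x : EuclideanSpace ℝ (Fin n)) :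
    ℝ :=
  Real.exp (-(b / 2) * (‖x‖ ^ 2 - x l ^ 2)) * χ ((‖x‖ ^ 2 - 2 * R * x l + R ^ 2) / L ^ 2)

/-- The error `r = H f - (n - 1) b f` of the quasimode `f`. -/
noncomputable def quasimodeError (χ : ℝ → ℝ) (α : ℝ) (l : Fin n) (b R L : ℝ)
    (x : EuclideanSpace ℝ (Fin n)) : ℝ :=
  let ρ := (‖x‖ ^ 2 - 2 * R * x l + R ^ 2) / L ^ 2
  Real.exp (-(b / 2) * (‖x‖ ^ 2 - x l ^ 2)) *
    (((‖x‖ ^ (-α)) ^ 2 - b ^ 2) * (‖x‖ ^ 2 - x l ^ 2) * χ ρ +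
      (4 * b / L ^ 2 * (‖x‖ ^ 2 - x l ^ 2) - 2 * n / L ^ 2) * deriv χ ρ -
      4 / L ^ 2 * ρ * deriv (deriv χ) ρ)

namespace HasAxialGradientAt

variable {l : Fin n} {x : EuclideanSpace ℝ (Fin n)}

lemma gaussian (b : ℝ) : HasAxialGradientAt l
    (fun x => Real.exp (-(b / 2) * (‖x‖ ^ 2 - x l ^ 2)))
    (-b * Real.exp (-(b / 2) * (‖x‖ ^ 2 - x l ^ 2)))
    (b * x l * Real.exp (-(b / 2) * (‖x‖ ^ 2 - x l ^ 2))) x := by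
  have h1 := (norm_sq (l := l) (x := x)).add
    ((const (-1)).mul ((coord (l := l) (x := x)).comp (hasDerivAt_pow 2 _)))
  have h2 := ((const (-(b / 2))).mul h1).comp (Real.hasDerivAt_exp _)
  have e : (fun x : EuclideanSpace ℝ (Fin n) => Real.exp (-(b / 2) * (‖x‖ ^ 2 - x l ^ 2))) =
      fun x => Real.exp (-(b / 2) * (‖x‖ ^ 2 + -1 * x l ^ 2)) := by
    funext y; ring_nf
  rw [e]
  refine h2.congr_coeff ?_ ?_
  · rw [congrFun e x]; ring
  · rw [congrFun e x]; push_cast; ring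

lemma cutoff {g : ℝ → ℝ} (hg : Differentiable ℝ g) (R L : ℝ) : HasAxialGradientAt l
    (fun x => g ((‖x‖ ^ 2 - 2 * R * x l + R ^ 2) / L ^ 2))
    (2 / L ^ 2 * deriv g ((‖x‖ ^ 2 - 2 * R * x l + R ^ 2) / L ^ 2))
    (-2 * R / L ^ 2 * deriv g ((‖x‖ ^ 2 - 2 * R * x l + R ^ 2) / L ^ 2)) x := by
  have h1 := ((norm_sq (l := l) (x := x)).add ((const (-2 * R)).mul coord)).add (const (R ^ 2))
  have h2 := ((const ((L ^ 2)⁻¹)).mul h1).comp (hg _).hasDerivAt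
  have e : ∀ x : EuclideanSpace ℝ (Fin n), (‖x‖ ^ 2 - 2 * R * x l + R ^ 2) / L ^ 2 =
      (L ^ 2)⁻¹ * (‖x‖ ^ 2 + -2 * R * x l + R ^ 2) := by
    intro y; ring
  simp only [e]
  exact h2.congr_coeff (by ring) (by ring)

end HasAxialGradientAt

variable {χ : ℝ → ℝ} {K b R L : ℝ} {l : Fin n}

lemma norm_sub_single_sq (l : Fin n) (R : ℝ) (x : EuclideanSpace ℝ (Fin n)) :
    ‖x - EuclideanSpace.single l R‖ ^ 2 = ‖x‖ ^ 2 - 2 * R * x l + R ^ 2 := by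
  rw [norm_sub_sq_real, EuclideanSpace.inner_single_right]
  simp
  ring

lemma tsupport_quasimode_subset (hχ : IsCutoff χ K) (hL : 0 < L) :
    tsupport (quasimode χ l b R L) ⊆ Metric.closedBall (EuclideanSpace.single l R) L := by
  refine closure_minimal (fun x hx => ?_) Metric.isClosed_closedBall
  by_contra h
  refine hx ?_
  rw [Metric.mem_closedBall, dist_eq_norm, not_le] at h
  rw [quasimode, hχ.eq_zero, mul_zero]
  rw [← norm_sub_single_sq, one_lt_div (by positivity)]
  gcongr

lemma contDiff_quasimode (hχ : IsCutoff χ K) : ContDiff ℝ ∞ (quasimode χ l b R L) := by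
  have h1 : ContDiff ℝ ∞ fun x : EuclideanSpace ℝ (Fin n) => x l :=
    (EuclideanSpace.proj (𝕜 := ℝ) l).contDiff
  have h2 : ContDiff ℝ ∞ fun x : EuclideanSpace ℝ (Fin n) => ‖x‖ ^ 2 := contDiff_norm_sq ℝ
  refine ContDiff.mul (Real.contDiff_exp.comp (contDiff_const.mul (h2.sub (h1.pow 2))))
    (hχ.contDiff.comp ?_)
  exact ((h2.sub (contDiff_const.mul h1)).add contDiff_const).div_const _

lemma isPuncturedTest_quasimode (hχ : IsCutoff χ K) (hL : 0 < L) (hLR : L < R) :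
    IsPuncturedTest fun x => (quasimode χ l b R L x : ℂ) := by
  have hsub : tsupport (fun x => (quasimode χ l b R L x : ℂ)) ⊆
      Metric.closedBall (EuclideanSpace.single l R) L :=
    (closure_mono fun x hx => by simpa using hx).trans (tsupport_quasimode_subset hχ hL)
  refine ⟨Complex.ofRealCLM.contDiff.comp (contDiff_quasimode hχ),
    HasCompactSupport.of_support_subset_isCompact (isCompact_closedBall _ _)
      (subset_closure.trans hsub), fun h => ?_⟩
  have := hsub h
  rw [Metric.mem_closedBall, dist_zero_left, PiLp.norm_single, Real.norm_eq_abs] at this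
  linarith [le_abs_self R]

/-- `H f = (n - 1) b f + r` pointwise, for the quasimode `f` and its error `r`. -/
lemma neg_sum_covariantDeriv_quasimode (hodd : Odd n) (α : ℝ) (hl : (l : ℕ) = n - 1)
    (hχ : IsCutoff χ K) (hL : 0 < L) (hLR : L < R) (x : EuclideanSpace ℝ (Fin n)) :
    -∑ j, covariantDeriv (magneticPotential n α) j
      (covariantDeriv (magneticPotential n α) j fun x => (quasimode χ l b R L x : ℂ)) x =
      (((n : ℝ) - 1) * b * quasimode χ l b R L x + quasimodeError χ α l b R L x : ℝ) := by
  have d0 : Differentiable ℝ χ := hχ.contDiff.differentiable (by simp)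
  have c1 : ContDiff ℝ ∞ (deriv χ) := (contDiff_infty_iff_deriv.1 hχ.contDiff).2
  have d1 : Differentiable ℝ (deriv χ) := c1.differentiable (by simp)
  have h0 : 0 ∉ tsupport (quasimode χ l b R L) := by
    intro h
    have := tsupport_quasimode_subset hχ hL h
    rw [Metric.mem_closedBall, dist_zero_left, PiLp.norm_single, Real.norm_eq_abs]
      at this
    linarith [le_abs_self R]
  set P : EuclideanSpace ℝ (Fin n) → ℝ := fun x => Real.exp (-(b / 2) * (‖x‖ ^ 2 - x l ^ 2))
    with hP
  set ρ : EuclideanSpace ℝ (Fin n) → ℝ := fun x => (‖x‖ ^ 2 - 2 * R * x l + R ^ 2) / L ^ 2 with hρ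
  set D : ℝ := 2 / L ^ 2 with hD
  have aP : ∀ x, HasAxialGradientAt l P (-b * P x) (b * x l * P x) x := fun x => .gaussian b
  have aQ : ∀ x, HasAxialGradientAt l (fun x => χ (ρ x)) (D * deriv χ (ρ x))
      (-R * D * deriv χ (ρ x)) x := fun x =>
    (HasAxialGradientAt.cutoff d0 R L).congr_coeff rfl (by rw [hD]; ring)
  have aQ1 : ∀ x, HasAxialGradientAt l (fun x => deriv χ (ρ x)) (D * deriv (deriv χ) (ρ x))
      (-R * D * deriv (deriv χ) (ρ x)) x := fun x =>
    (HasAxialGradientAt.cutoff d1 R L).congr_coeff rfl (by rw [hD]; ring)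
  have key := sum_covariantDeriv_covariantDeriv hodd α hl
    (v := quasimode χ l b R L)
    (β := fun x => P x * (-b * χ (ρ x) + D * deriv χ (ρ x)))
    (γ := fun x => P x * (b * (x l * χ (ρ x)) + -R * D * deriv χ (ρ x)))
    (fun x => ((aP x).mul (aQ x)).congr_coeff (by ring) (by ring))
    (fun x => (aP x).mul (((HasAxialGradientAt.const (-b)).mul (aQ x)).add
      ((HasAxialGradientAt.const D).mul (aQ1 x))))
    (fun x => (aP x).mul (((HasAxialGradientAt.const b).mul
      (HasAxialGradientAt.coord.mul (aQ x))).add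
      ((HasAxialGradientAt.const (-R * D)).mul (aQ1 x)))) h0 x
  rw [key, ← Complex.ofReal_neg]
  congr 1
  have e1 : quasimode χ l b R L x = P x * χ (ρ x) := rfl
  have e2 : quasimodeError χ α l b R L x = P x *
    (((‖x‖ ^ (-α)) ^ 2 - b ^ 2) * (‖x‖ ^ 2 - x l ^ 2) * χ (ρ x) +
      (2 * b * D * (‖x‖ ^ 2 - x l ^ 2) - n * D) * deriv χ (ρ x) -
      D * D * (‖x‖ ^ 2 - 2 * R * x l + R ^ 2) * deriv (deriv χ) (ρ x)) := by
    rw [quasimodeError]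
    simp only [hρ, hD]
    ring
  rw [e1, e2]
  ring

/-- `b|y|² + (x_l - R)²/L²`, the square of the distance to the centre of the quasimode, in the
units of its width in each direction. -/
noncomputable def rescaledDistSq (l : Fin n) (b R L : ℝ) (x : EuclideanSpace ℝ (Fin n)) : ℝ :=
  b * (‖x‖ ^ 2 - x l ^ 2) + ((x l - R) / L) ^ 2

lemma sq_coord_le (l : Fin n) (x : EuclideanSpace ℝ (Fin n)) : x l ^ 2 ≤ ‖x‖ ^ 2 := by
  rw [sq_le_sq, abs_norm]
  exact PiLp.norm_apply_le x l

/-- In the support of the cutoff, half of the Gaussian absorbs the polynomial factors, and the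
other half is comparable to a Gaussian in all variables. -/
lemma exp_half_mul_le (hb : 0 ≤ b) (hL : 0 < L) {x : EuclideanSpace ℝ (Fin n)}
    (hx : (‖x‖ ^ 2 - 2 * R * x l + R ^ 2) / L ^ 2 ≤ 1) :
    (1 + b * (‖x‖ ^ 2 - x l ^ 2)) * Real.exp (-(b / 2) * (‖x‖ ^ 2 - x l ^ 2)) ≤
      8 * Real.exp (-rescaledDistSq l b R L x / 4) := by
  set S := ‖x‖ ^ 2 - x l ^ 2 with hS
  have hS0 : 0 ≤ S := sub_nonneg.2 (sq_coord_le l x)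
  have hz : ((x l - R) / L) ^ 2 ≤ 1 := by
    refine le_trans ?_ hx
    rw [div_pow]
    gcongr
    linarith
  have h1 := Real.add_one_le_exp (b * S / 4)
  have h2 : (1 / 2 : ℝ) ≤ Real.exp (-(1 / 4)) := by
    have := Real.add_one_le_exp (-(1 / 4) : ℝ); linarith
  have h3 : Real.exp (-(b / 2) * S) = Real.exp (-(b * S / 4)) * Real.exp (-(b * S / 4)) := by
    rw [← Real.exp_add]; congr 1; ring
  have h4 : Real.exp (b * S / 4) * Real.exp (-(b * S / 4)) = 1 := by
    rw [← Real.exp_add]; simp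
  have h5 : Real.exp (-(b * S / 4)) * (1 / 2) ≤ Real.exp (-rescaledDistSq l b R L x / 4) := by
    have : Real.exp (-(b * S / 4)) * Real.exp (-(1 / 4)) ≤
        Real.exp (-rescaledDistSq l b R L x / 4) := by
      rw [← Real.exp_add, Real.exp_le_exp, rescaledDistSq, ← hS]
      linarith
    refine le_trans ?_ this
    gcongr
  have hbS : 0 ≤ b * S := mul_nonneg hb hS0
  calc (1 + b * S) * Real.exp (-(b / 2) * S)
      ≤ (4 * Real.exp (b * S / 4)) * Real.exp (-(b / 2) * S) := by gcongr; linarith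
    _ = 4 * Real.exp (-(b * S / 4)) := by
        rw [h3]; linear_combination 4 * Real.exp (-(b * S / 4)) * h4
    _ ≤ _ := by linarith

lemma abs_quasimode_le (hχ : IsCutoff χ K) (hb : 0 ≤ b) (hL : 0 < L)
    (x : EuclideanSpace ℝ (Fin n)) :
    |quasimode χ l b R L x| ≤ 8 * Real.exp (-rescaledDistSq l b R L x / 4) := by
  by_cases hx : (‖x‖ ^ 2 - 2 * R * x l + R ^ 2) / L ^ 2 ≤ 1
  · refine le_trans ?_ (exp_half_mul_le hb hL hx)
    have hS0 : 0 ≤ b * (‖x‖ ^ 2 - x l ^ 2) := mul_nonneg hb (sub_nonneg.2 (sq_coord_le l x))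
    rw [quasimode, abs_mul, Real.abs_exp, abs_of_nonneg (hχ.nonneg _), mul_comm]
    have := hχ.le_one ((‖x‖ ^ 2 - 2 * R * x l + R ^ 2) / L ^ 2)
    gcongr
    linarith
  · rw [quasimode, hχ.eq_zero _ (not_le.1 hx), mul_zero, abs_zero]
    positivity

lemma half_le_quasimode (hχ : IsCutoff χ K) (hL : 0 < L) (hbL : 1 ≤ b * L ^ 2)
    {x : EuclideanSpace ℝ (Fin n)} (hx : rescaledDistSq l b R L x ≤ 1 / 2) :
    1 / 2 ≤ quasimode χ l b R L x := by
  have hS0 : 0 ≤ ‖x‖ ^ 2 - x l ^ 2 := sub_nonneg.2 (sq_coord_le l x)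
  have h1 : (‖x‖ ^ 2 - 2 * R * x l + R ^ 2) / L ^ 2 =
      (‖x‖ ^ 2 - x l ^ 2) / L ^ 2 + ((x l - R) / L) ^ 2 := by
    rw [div_pow, ← add_div]; congr 1; ring
  have h2 : (‖x‖ ^ 2 - x l ^ 2) / L ^ 2 ≤ b * (‖x‖ ^ 2 - x l ^ 2) := by
    rw [div_le_iff₀ (by positivity)]
    nlinarith
  have h3 : 0 ≤ (‖x‖ ^ 2 - x l ^ 2) / L ^ 2 := by positivity
  have h4 : 0 ≤ ((x l - R) / L) ^ 2 := sq_nonneg _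
  rw [rescaledDistSq] at hx
  rw [quasimode, hχ.eq_one, mul_one]
  · have := Real.add_one_le_exp (-(b / 2) * (‖x‖ ^ 2 - x l ^ 2))
    linarith
  · rw [h1, abs_of_nonneg (by positivity)]
    linarith

lemma abs_rpow_neg_sq_sub_one_le {α t : ℝ} (hα₀ : 0 < α) (hα₂ : α < 2) (ht : |t - 1| ≤ 1 / 2) :
    |(t ^ (-α)) ^ 2 - 1| ≤ 128 * |t - 1| := by
  rw [abs_le] at ht
  have hpos : ∀ s ∈ Set.Icc (1 / 2 : ℝ) (3 / 2), 0 < s := fun s hs => by linarith [hs.1]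
  have h1 : ∀ s : ℝ, 0 < s → (s ^ (-α)) ^ 2 = s ^ (-(2 * α)) := by
    intro s hs
    rw [← Real.rpow_mul_natCast hs.le]; congr 1; push_cast; ring
  have hb := Convex.norm_image_sub_le_of_norm_hasDerivWithin_le
    (f := fun s : ℝ => (s ^ (-(2 * α)) : ℝ)) (f' := fun s : ℝ => -(2 * α) * s ^ (-(2 * α) - 1))
    (C := (128 : ℝ)) (s := Set.Icc (1 / 2 : ℝ) (3 / 2)) (x := (1 : ℝ)) (y := t)
    (fun (s : ℝ) hs => (Real.hasDerivAt_rpow_const (Or.inl (hpos s hs).ne')).hasDerivWithinAt)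
    (fun (s : ℝ) hs => by
      have h2 : s ^ (-(2 * α) - 1) ≤ 32 := by
        calc s ^ (-(2 * α) - 1) ≤ (1 / 2 : ℝ) ^ (-(2 * α) - 1) :=
              Real.rpow_le_rpow_of_nonpos (by norm_num) hs.1 (by linarith)
          _ ≤ (1 / 2 : ℝ) ^ (-5 : ℝ) :=
              Real.rpow_le_rpow_of_exponent_ge (by norm_num) (by norm_num) (by linarith)
          _ = 32 := by
              rw [Real.rpow_neg (by norm_num)]
              norm_num
      have h3 : 0 < s ^ (-(2 * α) - 1) := Real.rpow_pos_of_pos (hpos s hs) _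
      rw [Real.norm_eq_abs, abs_mul, abs_neg, abs_of_pos (by linarith : 0 < 2 * α), abs_of_pos h3]
      nlinarith)
    (convex_Icc _ _) ⟨by norm_num, by norm_num⟩ ⟨by linarith, by linarith⟩
  rw [h1 t (by linarith)]
  simpa using hb

/-- The condition `b L / R ≤ L⁻²` bounds the variation of `|x|^{-2α}|y|²` over the support by that
of the terms in which the cutoff is differentiated. -/
lemma abs_quasimodeError_le {α : ℝ} (hα₀ : 0 < α) (hα₂ : α < 2) (hχ : IsCutoff χ K)
    (hR : 0 < R) (hL : 0 < L) (hLR : L ≤ R / 2) (hLR' : R ^ (-α) * L / R ≤ (L ^ 2)⁻¹)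
    (x : EuclideanSpace ℝ (Fin n)) :
    |quasimodeError χ α l (R ^ (-α)) R L x| ≤
      (128 + (8 + 2 * n) * K) * 8 * (L ^ 2)⁻¹ *
        Real.exp (-rescaledDistSq l (R ^ (-α)) R L x / 4) := by
  have hK : 0 ≤ K := (abs_nonneg _).trans (hχ.deriv_le 0)
  set b := R ^ (-α) with hb
  have hb0 : 0 < b := Real.rpow_pos_of_pos hR _
  set ρ := (‖x‖ ^ 2 - 2 * R * x l + R ^ 2) / L ^ 2 with hρ
  set S := ‖x‖ ^ 2 - x l ^ 2 with hS
  have hS0 : 0 ≤ S := sub_nonneg.2 (sq_coord_le l x)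
  have hdef : quasimodeError χ α l b R L x = Real.exp (-(b / 2) * S) *
    (((‖x‖ ^ (-α)) ^ 2 - b ^ 2) * S * χ ρ + (4 * b / L ^ 2 * S - 2 * n / L ^ 2) * deriv χ ρ -
      4 / L ^ 2 * ρ * deriv (deriv χ) ρ) := rfl
  rw [hdef]
  by_cases hx : ρ ≤ 1
  · have hρ0 : 0 ≤ ρ := by rw [hρ, ← norm_sub_single_sq]; positivity
    have h1 : |‖x‖ - R| ≤ L := by
      have h2 : ‖x - EuclideanSpace.single l R‖ ≤ L := by
        rw [hρ, ← norm_sub_single_sq, div_le_one (by positivity)] at hx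
        exact (sq_le_sq₀ (norm_nonneg _) hL.le).1 hx
      have h3 := abs_norm_sub_norm_le x (EuclideanSpace.single l R)
      rw [PiLp.norm_single, Real.norm_of_nonneg hR.le] at h3
      exact h3.trans h2
    have h2 : |(‖x‖ ^ (-α)) ^ 2 - b ^ 2| ≤ 128 * b * (L ^ 2)⁻¹ := by
      set t := ‖x‖ / R with ht
      have htR : ‖x‖ = R * t := by rw [ht]; field_simp
      have ht0 : 0 ≤ t := by positivity
      have ht1 : |t - 1| ≤ L / R := by
        rw [htR] at h1
        rw [le_div_iff₀ hR]
        calc |t - 1| * R = |R * t - R| := by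
              rw [← abs_of_pos hR, ← abs_mul, abs_of_pos hR]; congr 1; ring
          _ ≤ L := h1
      have ht2 : |t - 1| ≤ 1 / 2 := by
        refine ht1.trans ?_
        rw [div_le_iff₀ hR]; linarith
      have h3 := abs_rpow_neg_sq_sub_one_le hα₀ hα₂ ht2
      rw [htR, Real.mul_rpow hR.le ht0, ← hb]
      have h4 : (b * t ^ (-α)) ^ 2 - b ^ 2 = b ^ 2 * ((t ^ (-α)) ^ 2 - 1) := by ring
      rw [h4, abs_mul, abs_of_nonneg (by positivity)]
      calc b ^ 2 * |(t ^ (-α)) ^ 2 - 1| ≤ b ^ 2 * (128 * (L / R)) := by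
            gcongr; exact h3.trans (by gcongr)
        _ = 128 * b * (b * L / R) := by ring
        _ ≤ _ := by gcongr
    have hmain : |((‖x‖ ^ (-α)) ^ 2 - b ^ 2) * S * χ ρ +
        (4 * b / L ^ 2 * S - 2 * n / L ^ 2) * deriv χ ρ - 4 / L ^ 2 * ρ * deriv (deriv χ) ρ| ≤
        (128 + (8 + 2 * n) * K) * (L ^ 2)⁻¹ * (1 + b * S) := by
      have a1 : |((‖x‖ ^ (-α)) ^ 2 - b ^ 2) * S * χ ρ| ≤ 128 * b * (L ^ 2)⁻¹ * S * 1 := by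
        rw [abs_mul, abs_mul, abs_of_nonneg hS0, abs_of_nonneg (hχ.nonneg _)]
        have := hχ.le_one ρ
        have := hχ.nonneg ρ
        gcongr
      have a2 : |(4 * b / L ^ 2 * S - 2 * n / L ^ 2) * deriv χ ρ| ≤
          (4 * b / L ^ 2 * S + 2 * n / L ^ 2) * K := by
        rw [abs_mul]
        have := hχ.deriv_le ρ
        gcongr
        refine (abs_sub _ _).trans ?_
        rw [abs_of_nonneg (by positivity), abs_of_nonneg (by positivity)]
      have a3 : |4 / L ^ 2 * ρ * deriv (deriv χ) ρ| ≤ 4 / L ^ 2 * 1 * K := by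
        rw [abs_mul, abs_mul, abs_of_nonneg hρ0, abs_of_nonneg (by positivity : 0 ≤ 4 / L ^ 2)]
        have := hχ.deriv_deriv_le ρ
        gcongr
      have a4 := abs_sub (((‖x‖ ^ (-α)) ^ 2 - b ^ 2) * S * χ ρ +
        (4 * b / L ^ 2 * S - 2 * n / L ^ 2) * deriv χ ρ) (4 / L ^ 2 * ρ * deriv (deriv χ) ρ)
      have a5 := abs_add_le (((‖x‖ ^ (-α)) ^ 2 - b ^ 2) * S * χ ρ)
        ((4 * b / L ^ 2 * S - 2 * n / L ^ 2) * deriv χ ρ)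
      have a6 : (128 + (8 + 2 * n) * K) * (L ^ 2)⁻¹ * (1 + b * S) =
          128 * b * (L ^ 2)⁻¹ * S * 1 + (4 * b / L ^ 2 * S + 2 * n / L ^ 2) * K +
          4 / L ^ 2 * 1 * K + (L ^ 2)⁻¹ * (128 + 4 * K + (4 + 2 * n) * K * (b * S)) := by
        ring
      have a7 : 0 ≤ (L ^ 2)⁻¹ * (128 + 4 * K + (4 + 2 * n) * K * (b * S)) := by positivity
      linarith
    rw [abs_mul, Real.abs_exp]
    calc Real.exp (-(b / 2) * S) * _
        ≤ Real.exp (-(b / 2) * S) * ((128 + (8 + 2 * n) * K) * (L ^ 2)⁻¹ * (1 + b * S)) := by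
          gcongr
      _ = (128 + (8 + 2 * n) * K) * (L ^ 2)⁻¹ * ((1 + b * S) * Real.exp (-(b / 2) * S)) := by ring
      _ ≤ (128 + (8 + 2 * n) * K) * (L ^ 2)⁻¹ *
          (8 * Real.exp (-rescaledDistSq l b R L x / 4)) := by
          have := exp_half_mul_le hb0.le hL hx
          gcongr
      _ = _ := by ring
  · rw [hχ.eq_zero _ (not_le.1 hx), hχ.deriv_eq_zero _ (not_le.1 hx),
      hχ.deriv_deriv_eq_zero _ (not_le.1 hx)]
    simp only [mul_zero, add_zero, sub_zero, abs_zero]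
    positivity

end Quasimode

/-! ### Strichartz estimates on quasimodes -/

section StrichartzQuasimode

variable {n : ℕ}

lemma enorm_inner_le_eLpNorm_mul_eLpNorm (p q : ℝ≥0∞) [ENNReal.HolderTriple p q 1] (f g : L2 n) :
    ‖⟪f, g⟫_ℂ‖ₑ ≤ eLpNorm f p volume * eLpNorm g q volume := by
  rw [L2.inner_def]
  refine (enorm_integral_le_lintegral_enorm _).trans ?_
  refine le_trans (le_of_eq ?_) (eLpNorm_smul_le_mul_eLpNorm (r := 1)
    (Lp.aestronglyMeasurable g) (Lp.aestronglyMeasurable f))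
  rw [eLpNorm_one_eq_lintegral_enorm]
  refine lintegral_congr fun x => ?_
  simp [RCLike.inner_apply, enorm_mul, mul_comm]

/-- A Strichartz estimate limits the time `T` during which a quasimode `f` is almost stationary:
`u(t) = e^{itH} f` keeps a fixed share of its overlap with `f` up to the time `‖f‖ / (2 ‖r‖)`, which
bounds `‖u(t)‖_q` from below by Hölder's inequality. -/
theorem rpow_mul_norm_le_of_strichartz [NeZero n]
    {A : EuclideanSpace ℝ (Fin n) → EuclideanSpace ℝ (Fin n)}
    (hA : IsLocallyL2Potential A) (hA' : IsSmoothOffZero A) {p q q' : ℝ≥0∞} (hp0 : p ≠ 0)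
    (hp : p ≠ ⊤) [ENNReal.HolderTriple q' q 1] {C : ℝ≥0}
    (hC : ∀ (f : L2 n) (u : ℝ → L2 n), IsMagneticSchrodingerSolution A f u →
      mixedNorm p q u ≤ C * ‖f‖ₑ)
    {f r : L2 n} {lam : ℝ} (hf : IsMagneticHamiltonian A f ((lam : ℂ) • f + r)) (hf0 : f ≠ 0)
    (hfq : eLpNorm f q' volume ≠ ⊤) {T : ℝ} (hT : 0 ≤ T) (hrT : ‖r‖ * T ≤ ‖f‖ / 2) :
    T ^ (1 / p.toReal) * (‖f‖ / 2) ≤ C * (eLpNorm f q' volume).toReal := by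
  have hfpos : 0 < ‖f‖ := norm_pos_iff.2 hf0
  obtain ⟨u, hu, hu0, hun, hud⟩ := exists_formOperator_evolution (isClosed_magneticGraph hA)
    (fun g hg => eq_zero_of_forall_magneticGradient hA' g fun φ Φ h => hg φ (WithLp.toLp 2 Φ) h)
    ((isMagneticHamiltonian_iff_formOperator hA _ _).1 hf)
  have hsol : IsMagneticSchrodingerSolution A f u :=
    ⟨hu, hu0, fun φ ψ h => hud φ ψ ((isMagneticHamiltonian_iff_formOperator hA _ _).1 h)⟩
  set N := eLpNorm f q' volume with hN
  have hlow : ∀ t ∈ Set.Icc 0 T, ENNReal.ofReal (‖f‖ ^ 2 / 2) ≤ N * eLpNorm (u t) q volume := by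
    intro t ht
    refine le_trans ?_ (enorm_inner_le_eLpNorm_mul_eLpNorm q' q f (u t))
    rw [← ofReal_norm]
    refine ENNReal.ofReal_le_ofReal ?_
    have h1 := norm_inner_ge_of_quasimode (fun t => (hun t).le) (hsol.2.2 f _ hf) t
    rw [hu0, inner_self_eq_norm_sq_to_K, abs_of_nonneg ht.1] at h1
    have h2 : ‖r‖ * ‖f‖ * t ≤ ‖f‖ ^ 2 / 2 := by
      calc ‖r‖ * ‖f‖ * t ≤ ‖r‖ * ‖f‖ * T := by gcongr; exact ht.2
        _ = ‖f‖ * (‖r‖ * T) := by ring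
        _ ≤ ‖f‖ * (‖f‖ / 2) := by gcongr
        _ = _ := by ring
    have h3 : ‖((‖f‖ : ℂ)) ^ 2‖ = ‖f‖ ^ 2 := by simp
    have h4 : ‖((‖f‖ : ℂ)) ^ 2‖ - ‖r‖ * ‖f‖ * t ≤ ‖⟪f, u t⟫_ℂ‖ := h1
    rw [h3] at h4
    linarith
  have hmix : ENNReal.ofReal (‖f‖ ^ 2 / 2) / N * ENNReal.ofReal T ^ (1 / p.toReal) ≤
      C * ‖f‖ₑ := by
    refine le_trans ?_ (hC f u hsol)
    have h1 := eLpNorm_indicator_const (c := ENNReal.ofReal (‖f‖ ^ 2 / 2) / N)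
      (μ := (volume : Measure ℝ)) (s := Set.Icc 0 T) measurableSet_Icc hp0 hp
    rw [Real.volume_Icc, sub_zero, enorm_eq_self] at h1
    rw [← h1, mixedNorm]
    refine eLpNorm_mono_enorm fun t => ?_
    simp only [enorm_eq_self, Set.indicator]
    split_ifs with ht
    · exact ENNReal.div_le_of_le_mul' (hlow t ht)
    · exact zero_le
  have hN0 : N ≠ 0 := by
    intro h
    have := hlow 0 ⟨le_rfl, hT⟩
    rw [h, zero_mul, nonpos_iff_eq_zero, ENNReal.ofReal_eq_zero] at this
    nlinarith
  have h1 : ENNReal.ofReal (‖f‖ ^ 2 / 2) * ENNReal.ofReal T ^ (1 / p.toReal) ≤ C * ‖f‖ₑ * N := by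
    calc _ = ENNReal.ofReal (‖f‖ ^ 2 / 2) / N * ENNReal.ofReal T ^ (1 / p.toReal) * N := by
          rw [mul_right_comm, ENNReal.div_mul_cancel hN0 hfq]
      _ ≤ _ := by gcongr
  have h2 := ENNReal.toReal_mono
    (ENNReal.mul_ne_top (ENNReal.mul_ne_top ENNReal.coe_ne_top enorm_ne_top) hfq) h1
  rw [ENNReal.toReal_mul, ENNReal.toReal_mul, ENNReal.toReal_mul, ← ENNReal.toReal_rpow,
    ENNReal.toReal_ofReal hT, ENNReal.toReal_ofReal (by positivity), toReal_enorm,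
    ENNReal.coe_toReal] at h2
  refine le_of_mul_le_mul_left ?_ hfpos
  linarith

end StrichartzQuasimode

/-! ### Anisotropic rescaling -/

section Rescaling

variable {n : ℕ}

lemma eLpNorm_comp_diagonal (d : Fin n → ℝ) (hd : ∏ i, d i ≠ 0) (c : EuclideanSpace ℝ (Fin n))
    {g : EuclideanSpace ℝ (Fin n) → ℝ} (hg : Measurable g) {s : ℝ≥0∞} (hs : s ≠ ⊤) :
    eLpNorm (fun x => g (Matrix.toEuclideanLin (Matrix.diagonal d) (x - c))) s volume =
      ENNReal.ofReal |(∏ i, d i)⁻¹| ^ (1 / s).toReal * eLpNorm g s volume := by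
  set D := Matrix.toEuclideanLin (Matrix.diagonal d) with hD
  have hdet : LinearMap.det D = ∏ i, d i := by
    rw [hD, Matrix.toEuclideanLin, Matrix.toLpLin_eq_toLin, LinearMap.det_toLin,
      Matrix.det_diagonal]
  have hDm : Measurable D := (LinearMap.continuous_of_finiteDimensional D).measurable
  have h1 := eLpNorm_comp_measurePreserving (p := s) (g := fun x => g (D x))
    (hg.comp hDm).aestronglyMeasurable (measurePreserving_sub_right volume c)
  have h2 := eLpNorm_map_measure (p := s) (μ := (volume : Measure (EuclideanSpace ℝ (Fin n))))
    (f := D) (g := g) hg.aestronglyMeasurable hDm.aemeasurable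
  rw [Measure.map_linearMap_addHaar_eq_smul_addHaar _ (by rwa [hdet]), hdet,
    eLpNorm_smul_measure_of_ne_top hs, smul_eq_mul] at h2
  rw [h2]
  exact h1

lemma norm_sq_diagonal_sub_single (l : Fin n) {b R L : ℝ} (hb : 0 ≤ b)
    (x : EuclideanSpace ℝ (Fin n)) :
    ‖Matrix.toEuclideanLin (Matrix.diagonal fun j => if j = l then L⁻¹ else √b)
      (x - EuclideanSpace.single l R)‖ ^ 2 = rescaledDistSq l b R L x := by
  rw [EuclideanSpace.real_norm_sq_eq, rescaledDistSq, EuclideanSpace.real_norm_sq_eq]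
  have h : ∀ j, (Matrix.toEuclideanLin (Matrix.diagonal fun j => if j = l then L⁻¹ else √b)
      (x - EuclideanSpace.single l R)) j ^ 2 =
      b * x j ^ 2 + if j = l then ((x j - R) / L) ^ 2 - b * x j ^ 2 else 0 := by
    intro j
    rw [Matrix.toLpLin_apply]
    simp only [Matrix.mulVec_diagonal]
    by_cases hj : j = l
    · subst hj
      simp; ring
    · simp [hj, mul_pow, Real.sq_sqrt hb]
  simp only [h]
  rw [Finset.sum_add_distrib, Finset.sum_ite_eq', ← Finset.mul_sum]
  simp only [Finset.mem_univ, if_true]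
  ring

lemma memLp_exp_neg_norm_sq {s : ℝ≥0∞} (hs0 : s ≠ 0) (hs : s ≠ ⊤) :
    MemLp (fun x : EuclideanSpace ℝ (Fin n) => Real.exp (-‖x‖ ^ 2 / 4)) s volume := by
  have hc : Continuous fun x : EuclideanSpace ℝ (Fin n) => Real.exp (-‖x‖ ^ 2 / 4) := by fun_prop
  rw [← integrable_norm_rpow_iff hc.aestronglyMeasurable hs0 hs]
  have hpos : 0 < s.toReal := ENNReal.toReal_pos hs0 hs
  have h := (GaussianFourier.integrable_cexp_neg_mul_sq_norm_add
    (V := EuclideanSpace ℝ (Fin n)) (b := ((s.toReal / 4 : ℝ) : ℂ))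
    (by rw [Complex.ofReal_re]; positivity) 0 0).norm
  refine h.congr (Filter.Eventually.of_forall fun x => ?_)
  dsimp only
  rw [Complex.norm_exp, Real.norm_of_nonneg (Real.exp_pos _).le, ← Real.exp_mul]
  congr 1
  have e : -((s.toReal / 4 : ℝ) : ℂ) * (‖x‖ : ℂ) ^ 2 + 0 * ((inner ℝ 0 x : ℝ) : ℂ) =
      ((-(s.toReal / 4) * ‖x‖ ^ 2 : ℝ) : ℂ) := by
    push_cast; ring
  rw [e, Complex.ofReal_re]
  ring

end Rescaling

/-! ### Norms of the quasimode -/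

section QuasimodeNorms

variable {n : ℕ} {χ : ℝ → ℝ} {K b R L : ℝ} {l : Fin n}

lemma abs_inv_prod_width (hb : 0 < b) (hL : 0 < L) (l : Fin n) :
    |(∏ j, if j = l then L⁻¹ else √b)⁻¹| = (√b ^ (n - 1))⁻¹ * L := by
  rw [Finset.prod_ite, Finset.prod_const, Finset.prod_const, Finset.filter_eq',
    if_pos (Finset.mem_univ l), Finset.card_singleton, pow_one,
    Finset.filter_ne', Finset.card_erase_of_mem (Finset.mem_univ l), Finset.card_univ,
    Fintype.card_fin, mul_inv, inv_inv, abs_of_nonneg (by positivity), mul_comm]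

/-- A function dominated by the rescaled Gaussian has `L^s` norm at most a multiple of
`V^{1/s}`, where `V = b^{-(n-1)/2} L`. -/
lemma toReal_eLpNorm_le_of_le_gaussian (hb : 0 < b) (hL : 0 < L) {s : ℝ≥0∞} (hs0 : s ≠ 0)
    (hs : s ≠ ⊤) {w : EuclideanSpace ℝ (Fin n) → ℂ} {M : ℝ} (hM : 0 ≤ M)
    (hw : ∀ x, ‖w x‖ ≤ M * Real.exp (-rescaledDistSq l b R L x / 4)) :
    eLpNorm w s volume ≠ ⊤ ∧ (eLpNorm w s volume).toReal ≤
      M * (((√b ^ (n - 1))⁻¹ * L) ^ (1 / s).toReal *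
        (eLpNorm (fun x : EuclideanSpace ℝ (Fin n) => Real.exp (-‖x‖ ^ 2 / 4)) s
          volume).toReal) := by
  set d : Fin n → ℝ := fun j => if j = l then L⁻¹ else √b with hd
  have hsb : 0 < √b := Real.sqrt_pos.2 hb
  have hd0 : ∏ i, d i ≠ 0 := Finset.prod_ne_zero_iff.2 fun j _ => by
    simp only [hd]; split_ifs <;> positivity
  set g : EuclideanSpace ℝ (Fin n) → ℝ := fun x => Real.exp (-‖x‖ ^ 2 / 4) with hg
  have hgm : Measurable g := (by fun_prop : Continuous g).measurable
  have h1 := eLpNorm_comp_diagonal d hd0 (EuclideanSpace.single l R) hgm hs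
  rw [abs_inv_prod_width hb hL] at h1
  have h2 : eLpNorm w s volume ≤ ENNReal.ofReal M * eLpNorm (fun x =>
      g (Matrix.toEuclideanLin (Matrix.diagonal d) (x - EuclideanSpace.single l R))) s volume := by
    refine eLpNorm_le_mul_eLpNorm_of_ae_le_mul (Filter.Eventually.of_forall fun x => ?_) s
    rw [hg, Real.norm_of_nonneg (Real.exp_pos _).le, norm_sq_diagonal_sub_single l hb.le]
    exact hw x
  rw [h1] at h2
  have htop : ENNReal.ofReal M * (ENNReal.ofReal ((√b ^ (n - 1))⁻¹ * L) ^ (1 / s).toReal *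
      eLpNorm g s volume) ≠ ⊤ :=
    ENNReal.mul_ne_top ENNReal.ofReal_ne_top (ENNReal.mul_ne_top
      (ENNReal.rpow_ne_top_of_nonneg ENNReal.toReal_nonneg ENNReal.ofReal_ne_top)
      (memLp_exp_neg_norm_sq hs0 hs).eLpNorm_ne_top)
  refine ⟨ne_top_of_le_ne_top htop h2, (ENNReal.toReal_mono htop h2).trans_eq ?_⟩
  rw [ENNReal.toReal_mul, ENNReal.toReal_mul, ENNReal.toReal_ofReal hM, ← ENNReal.toReal_rpow,
    ENNReal.toReal_ofReal (by positivity)]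

lemma le_toReal_eLpNorm_quasimode (hb : 0 < b) (hL : 0 < L) (hbL : 1 ≤ b * L ^ 2)
    (hχ : IsCutoff χ K)
    (hfin : eLpNorm (fun x => (quasimode χ l b R L x : ℂ)) 2 volume ≠ ⊤) :
    ((√b ^ (n - 1))⁻¹ * L) ^ (1 / 2 : ℝ) * (1 / 2 * (eLpNorm (Set.indicator
      (Metric.closedBall (0 : EuclideanSpace ℝ (Fin n)) (1 / 2)) fun _ => (1 : ℝ)) 2
        volume).toReal) ≤
      (eLpNorm (fun x => (quasimode χ l b R L x : ℂ)) 2 volume).toReal := by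
  set d : Fin n → ℝ := fun j => if j = l then L⁻¹ else √b with hd
  have hsb : 0 < √b := Real.sqrt_pos.2 hb
  have hd0 : ∏ i, d i ≠ 0 := Finset.prod_ne_zero_iff.2 fun j _ => by
    simp only [hd]; split_ifs <;> positivity
  set g : EuclideanSpace ℝ (Fin n) → ℝ := Set.indicator
    (Metric.closedBall (0 : EuclideanSpace ℝ (Fin n)) (1 / 2)) fun _ => (1 : ℝ) with hg
  have hgm : Measurable g := measurable_const.indicator measurableSet_closedBall
  have h1 := eLpNorm_comp_diagonal d hd0 (EuclideanSpace.single l R) hgm ENNReal.ofNat_ne_top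
    (s := 2)
  rw [abs_inv_prod_width hb hL] at h1
  have h2 : eLpNorm (fun x =>
      g (Matrix.toEuclideanLin (Matrix.diagonal d) (x - EuclideanSpace.single l R))) 2 volume ≤
      ENNReal.ofReal 2 * eLpNorm (fun x => (quasimode χ l b R L x : ℂ)) 2 volume := by
    refine eLpNorm_le_mul_eLpNorm_of_ae_le_mul (Filter.Eventually.of_forall fun x => ?_) 2
    simp only [hg, Set.indicator, mem_closedBall_zero_iff]
    split_ifs with hx
    · have h3 : rescaledDistSq l b R L x ≤ 1 / 2 := by
        rw [← norm_sq_diagonal_sub_single l hb.le]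
        have h4 := norm_nonneg
          (Matrix.toEuclideanLin (Matrix.diagonal d) (x - EuclideanSpace.single l R))
        change ‖Matrix.toEuclideanLin (Matrix.diagonal d) (x - EuclideanSpace.single l R)‖ ^ 2 ≤ _
        nlinarith
      have h5 := half_le_quasimode hχ hL hbL h3
      rw [Complex.norm_real, norm_one, Real.norm_eq_abs]
      linarith [le_abs_self (quasimode χ l b R L x)]
    · rw [norm_zero]; positivity
  rw [h1] at h2
  have h3 := ENNReal.toReal_mono (ENNReal.mul_ne_top ENNReal.ofReal_ne_top hfin) h2
  rw [ENNReal.toReal_mul, ENNReal.toReal_mul, ENNReal.toReal_ofReal zero_le_two,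
    ← ENNReal.toReal_rpow, ENNReal.toReal_ofReal (by positivity)] at h3
  have e : (1 / 2 : ℝ≥0∞).toReal = 1 / 2 := by simp
  rw [e] at h3
  linarith

lemma memLp_quasimodeError (hodd : Odd n) (α : ℝ) (hl : (l : ℕ) = n - 1) (hχ : IsCutoff χ K)
    (hL : 0 < L) (hLR : L < R) :
    MemLp (fun x => (quasimodeError χ α l b R L x : ℂ)) 2 volume := by
  have ht := isPuncturedTest_quasimode (b := b) (l := l) hχ hL hLR
  have hA := isSmoothOffZero_magneticPotential hodd α
  have e : (fun x => (quasimodeError χ α l b R L x : ℂ)) = fun x =>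
      -(∑ j, covariantDeriv (magneticPotential n α) j
        (covariantDeriv (magneticPotential n α) j fun x => (quasimode χ l b R L x : ℂ)) x) -
      (((n : ℝ) - 1) * b : ℝ) * (quasimode χ l b R L x : ℂ) := by
    funext x
    rw [neg_sum_covariantDeriv_quasimode hodd α hl hχ hL hLR]
    push_cast; ring
  rw [e]
  exact (memLp_finsetSum _ fun j _ =>
    ((ht.covariantDeriv hA j).covariantDeriv hA j).memLp 2).neg.sub ((ht.memLp 2).const_mul _)

end QuasimodeNorms

/-! ### Failure of the Strichartz estimates -/

section Counterexample

variable {n : ℕ}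

/-- The exponent `q'` is the conjugate of `q`; its defining relation is the admissibility condition
with `1/q = 1 - 1/q'`. -/
lemma exponents_of_schrodingerAdmissible (hn : 3 ≤ n) {p q : ℝ≥0∞}
    (hpq : SchrodingerAdmissible n p q) (hne : (p, q) ≠ (⊤, 2)) :
    p ≠ ⊤ ∧ ∃ q' : ℝ≥0∞, q' ≠ 0 ∧ q' ≠ ⊤ ∧ ENNReal.HolderTriple q' q 1 ∧
      (1 / q').toReal = 1 / 2 + 2 / n * (1 / p.toReal) := by
  obtain ⟨h, hp2, -⟩ := hpq
  have hn0 : (n : ℝ≥0∞) ≠ 0 := by exact_mod_cast (by omega : n ≠ 0)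
  have hnt : (n : ℝ≥0∞) ≠ ⊤ := ENNReal.natCast_ne_top n
  have hn3 : (3 : ℝ) ≤ n := by exact_mod_cast hn
  have hp0 : p ≠ 0 := by
    rintro rfl; simp at hp2
  have hrhs : (n : ℝ≥0∞) / 2 ≠ ⊤ := ENNReal.div_ne_top hnt two_ne_zero
  have hqn : (n : ℝ≥0∞) / q ≠ ⊤ := fun h' => hrhs (by rw [← h, h', add_top])
  have hq0 : q ≠ 0 := by
    rintro rfl; exact hqn (ENNReal.div_zero hn0)
  have h2p : (2 : ℝ≥0∞) / p ≠ ⊤ := ENNReal.div_ne_top (by simp) hp0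
  have hreal : 2 * (1 / p).toReal + n * (q⁻¹).toReal = n / 2 := by
    have := congrArg ENNReal.toReal h
    rw [ENNReal.toReal_add h2p hqn, ENNReal.toReal_div, ENNReal.toReal_div, ENNReal.toReal_div]
      at this
    simp only [ENNReal.toReal_ofNat, ENNReal.toReal_natCast] at this
    rw [ENNReal.toReal_div, ENNReal.toReal_inv]
    simp only [ENNReal.toReal_one]
    rw [← this]; ring
  have hqi : q⁻¹ ≠ ⊤ := ENNReal.inv_ne_top.2 hq0
  have hp : p ≠ ⊤ := by
    rintro rfl
    refine hne ?_
    simp only [ENNReal.div_top, ENNReal.toReal_zero, mul_zero, zero_add] at hreal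
    have h1 : (q⁻¹).toReal = (2⁻¹ : ℝ≥0∞).toReal := by
      have h2 : (2⁻¹ : ℝ≥0∞).toReal = 1 / 2 := by simp
      rw [h2]
      refine mul_left_cancel₀ (by positivity : (n : ℝ) ≠ 0) ?_
      linarith
    rw [ENNReal.toReal_eq_toReal_iff' hqi (by simp), inv_inj] at h1
    rw [h1]
  have h1p : (1 / p).toReal = 1 / p.toReal := by
    rw [ENNReal.toReal_div, ENNReal.toReal_one]
  rw [h1p] at hreal
  have hppos : 0 < 1 / p.toReal := by
    have := ENNReal.toReal_pos hp0 hp; positivity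
  have hp2' : 1 / p.toReal ≤ 1 / 2 := by
    have : (2 : ℝ) ≤ p.toReal := by
      have := ENNReal.toReal_mono hp hp2; simpa using this
    exact one_div_le_one_div_of_le (by norm_num) this
  have hqr : (q⁻¹).toReal = 1 / 2 - 2 / n * (1 / p.toReal) := by
    refine mul_left_cancel₀ (by positivity : (n : ℝ) ≠ 0) ?_
    have h1 : (n : ℝ) * (2 / n * (1 / p.toReal)) = 2 * (1 / p.toReal) := by field_simp
    linarith
  have hq1 : q⁻¹ < 1 := by
    rw [← ENNReal.toReal_lt_toReal hqi ENNReal.one_ne_top, hqr, ENNReal.toReal_one]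
    have : 0 < 2 / (n : ℝ) * (1 / p.toReal) := by positivity
    linarith
  refine ⟨hp, (1 - q⁻¹)⁻¹, ?_, ?_, ⟨?_⟩, ?_⟩
  · exact ENNReal.inv_ne_zero.2 (ne_top_of_le_ne_top ENNReal.one_ne_top tsub_le_self)
  · exact ENNReal.inv_ne_top.2 (tsub_pos_iff_lt.2 hq1).ne'
  · rw [inv_inv, inv_one, tsub_add_cancel_of_le hq1.le]
  · rw [one_div, inv_inv, ENNReal.toReal_sub_of_le hq1.le ENNReal.one_ne_top, hqr,
      ENNReal.toReal_one]
    ring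

/-- The Strichartz inequality for the quasimode at distance `R` from the origin, of volume
`V = b^{-(n-1)/2} L`: it bounds `(L²)^{1/p}` by a multiple of `V^{2/(np)}`. -/
lemma exists_rpow_le_of_strichartz (hn : 3 ≤ n) (hodd : Odd n) {α : ℝ} (hα₀ : 0 < α) (hα₂ : α < 2)
    {p q q' : ℝ≥0∞} (hp0 : p ≠ 0) (hp : p ≠ ⊤) (hq0 : q' ≠ 0) (hqt : q' ≠ ⊤)
    (hqq : ENNReal.HolderTriple q' q 1) (hS : StrichartzEstimate (magneticPotential n α) p q) :
    ∃ B : ℝ, ∀ R L : ℝ, 0 < R → 0 < L → L ≤ R / 2 → R ^ (-α) * L / R ≤ (L ^ 2)⁻¹ →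
      1 ≤ R ^ (-α) * L ^ 2 →
      (L ^ 2) ^ (1 / p.toReal) ≤
        B * ((√(R ^ (-α)) ^ (n - 1))⁻¹ * L) ^ ((1 / q').toReal - 1 / 2) := by
  obtain ⟨C, hC⟩ := hS
  obtain ⟨χ, K, hχ⟩ := exists_isCutoff
  have : NeZero n := ⟨by omega⟩
  let l : Fin n := ⟨n - 1, by omega⟩
  have hl : (l : ℕ) = n - 1 := rfl
  have hA := isLocallyL2Potential_magneticPotential hn hodd hα₂
  have hA' := isSmoothOffZero_magneticPotential hodd α
  have hK : 0 ≤ K := (abs_nonneg _).trans (hχ.deriv_le 0)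
  set g : EuclideanSpace ℝ (Fin n) → ℝ := fun x => Real.exp (-‖x‖ ^ 2 / 4) with hg
  set c₁ : ℝ := 1 / 2 * (eLpNorm (Set.indicator
      (Metric.closedBall (0 : EuclideanSpace ℝ (Fin n)) (1 / 2)) fun _ => (1 : ℝ)) 2
        volume).toReal with hc₁
  have hc₁pos : 0 < c₁ := by
    rw [hc₁, eLpNorm_indicator_const measurableSet_closedBall two_ne_zero ENNReal.ofNat_ne_top,
      enorm_one, one_mul, ← ENNReal.toReal_rpow]
    have : 0 < (volume (Metric.closedBall (0 : EuclideanSpace ℝ (Fin n)) (1 / 2))).toReal :=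
      ENNReal.toReal_pos (Metric.measure_closedBall_pos _ _ (by norm_num)).ne'
        measure_closedBall_lt_top.ne
    positivity
  set M : ℝ := (128 + (8 + 2 * n) * K) * 8 with hM
  have hMpos : 0 < M := by positivity
  set c₂ : ℝ := M * ((eLpNorm g 2 volume).toReal + 1) with hc₂
  have hc₂pos : 0 < c₂ := by positivity
  set c₃ : ℝ := 8 * (eLpNorm g q' volume).toReal with hc₃
  set a := 1 / p.toReal with ha
  -- The quasimode is almost stationary up to time `c₄ L²`.
  set c₄ : ℝ := c₁ / (2 * c₂) with hc₄
  have hc₄pos : 0 < c₄ := by positivity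
  refine ⟨C * c₃ * 2 / (c₁ * c₄ ^ a), fun R L hR hL hLR hLR' hbL => ?_⟩
  set b := R ^ (-α) with hb
  have hb0 : 0 < b := Real.rpow_pos_of_pos hR _
  have hsb : 0 < √b := Real.sqrt_pos.2 hb0
  set V := (√b ^ (n - 1))⁻¹ * L with hV
  have hVpos : 0 < V := by positivity
  have hLR'' : L < R := by linarith
  have ht := isPuncturedTest_quasimode (b := b) (l := l) hχ hL hLR''
  have hmv := ht.memLp 2
  have hmr := memLp_quasimodeError (b := b) hodd α hl hχ hL hLR''
  set f : L2 n := hmv.toLp with hf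
  set r : L2 n := hmr.toLp with hr
  have hH : IsMagneticHamiltonian (magneticPotential n α) f
      (((((n : ℝ) - 1) * b : ℝ) : ℂ) • f + r) := by
    refine ht.isMagneticHamiltonian hA'
      ((hmv.const_smul ((((n : ℝ) - 1) * b : ℝ) : ℂ)).add hmr) fun x => ?_
    rw [neg_sum_covariantDeriv_quasimode hodd α hl hχ hL hLR'']
    simp
  have e2 : (1 / 2 : ℝ≥0∞).toReal = 1 / 2 := by simp
  have hfnorm : V ^ (1 / 2 : ℝ) * c₁ ≤ ‖f‖ := by
    rw [hf, Lp.norm_toLp]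
    exact le_toReal_eLpNorm_quasimode hb0 hL hbL hχ hmv.eLpNorm_ne_top
  have hrnorm : ‖r‖ ≤ (L ^ 2)⁻¹ * V ^ (1 / 2 : ℝ) * c₂ := by
    have h1 := (toReal_eLpNorm_le_of_le_gaussian (l := l) (R := R) hb0 hL two_ne_zero
      ENNReal.ofNat_ne_top (M := M * (L ^ 2)⁻¹) (by positivity)
      (w := fun x => (quasimodeError χ α l b R L x : ℂ)) (fun x => by
        rw [Complex.norm_real]
        exact abs_quasimodeError_le hα₀ hα₂ hχ hR hL hLR hLR' x)).2
    rw [hr, Lp.norm_toLp]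
    refine h1.trans ?_
    rw [e2, hc₂]
    have h2 : 0 ≤ (L ^ 2)⁻¹ * V ^ (1 / 2 : ℝ) * M := by positivity
    linarith
  obtain ⟨hqfin, hqle⟩ := toReal_eLpNorm_le_of_le_gaussian (l := l) (R := R) hb0 hL hq0 hqt
    (M := 8) (by norm_num) (w := fun x => (quasimode χ l b R L x : ℂ)) (fun x => by
      rw [Complex.norm_real]
      exact abs_quasimode_le hχ hb0.le hL x)
  have hfq : eLpNorm f q' volume = eLpNorm (fun x => (quasimode χ l b R L x : ℂ)) q' volume :=
    eLpNorm_congr_ae hmv.coeFn_toLp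
  rw [← hfq] at hqfin hqle
  have hfpos : 0 < ‖f‖ := lt_of_lt_of_le (by positivity) hfnorm
  have hT : ‖r‖ * (c₄ * L ^ 2) ≤ ‖f‖ / 2 := by
    calc ‖r‖ * (c₄ * L ^ 2) ≤ ((L ^ 2)⁻¹ * V ^ (1 / 2 : ℝ) * c₂) * (c₄ * L ^ 2) := by gcongr
      _ = V ^ (1 / 2 : ℝ) * c₁ / 2 := by rw [hc₄]; field_simp
      _ ≤ _ := by gcongr
  have key := rpow_mul_norm_le_of_strichartz hA hA' hp0 hp hC hH (norm_pos_iff.1 hfpos) hqfin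
    (T := c₄ * L ^ 2) (by positivity) hT
  rw [← ha, Real.mul_rpow hc₄pos.le (by positivity)] at key
  have h1 : c₄ ^ a * (L ^ 2) ^ a * (V ^ (1 / 2 : ℝ) * c₁ / 2) ≤
      C * (8 * (V ^ (1 / q').toReal * (eLpNorm g q' volume).toReal)) := by
    calc _ ≤ c₄ ^ a * (L ^ 2) ^ a * (‖f‖ / 2) := by gcongr
      _ ≤ _ := key
      _ ≤ _ := by gcongr
  rw [Real.rpow_sub hVpos, div_mul_div_comm, le_div_iff₀ (by positivity)]
  have h2 : (L ^ 2) ^ a * (c₁ * c₄ ^ a * V ^ (1 / 2 : ℝ)) =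
      2 * (c₄ ^ a * (L ^ 2) ^ a * (V ^ (1 / 2 : ℝ) * c₁ / 2)) := by ring
  rw [h2]
  refine (mul_le_mul_of_nonneg_left h1 zero_le_two).trans_eq ?_
  rw [hc₃]; ring

end Counterexample

theorem theorem1p1 (n : ℕ) (hn : 3 ≤ n) (hodd : Odd n) (α : ℝ) (hα₁ : 1 < α) (hα₂ : α < 2)
    (p q : ℝ≥0∞) (hpq : SchrodingerAdmissible n p q) (hne : (p, q) ≠ (⊤, 2)) :
    ¬ StrichartzEstimate (magneticPotential n α) p q := by
  intro hS
  have hp0 : p ≠ 0 := by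
    rintro rfl; simpa using hpq.2.1
  obtain ⟨hp, q', hq0, hqt, hqq, hexp⟩ := exponents_of_schrodingerAdmissible hn hpq hne
  obtain ⟨B, hB⟩ := exists_rpow_le_of_strichartz hn hodd (by linarith) hα₂ hp0 hp hq0 hqt hqq hS
  have hn3 : (3 : ℝ) ≤ n := by exact_mod_cast hn
  set a := 1 / p.toReal with ha
  have ha0 : 0 < a := by
    have := ENNReal.toReal_pos hp0 hp; positivity
  -- The length scale is `L = R ^ γ` with `γ` the midpoint of `α / 2 < (α + 1) / 3`.
  set γ : ℝ := (α / 2 + (α + 1) / 3) / 2 with hγ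
  have hγ₁ : α / 2 < γ := by rw [hγ]; linarith
  have hγ₂ : 3 * γ < α + 1 := by rw [hγ]; linarith
  have hγ₃ : γ < 1 := by linarith
  set κ : ℝ := γ * 2 * a - (α / 2 * (n - 1) + γ) * (2 / n * a) with hκ
  have hκ0 : 0 < κ := by
    have : κ = 2 * a * (n - 1) / n * (γ - α / 2) := by
      rw [hκ]; field_simp; ring
    rw [this]
    have h1 : 0 < γ - α / 2 := by linarith
    have h2 : 0 < (n : ℝ) - 1 := by linarith
    positivity
  have hev : ∀ᶠ R : ℝ in Filter.atTop, 1 ≤ R ∧ 2 ≤ R ^ (1 - γ) ∧ B < R ^ κ :=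
    (Filter.eventually_ge_atTop 1).and
      (((tendsto_rpow_atTop (by linarith : 0 < 1 - γ)).eventually_ge_atTop 2).and
        ((tendsto_rpow_atTop hκ0).eventually_gt_atTop B))
  obtain ⟨R, hR1, hR2, hRB⟩ := hev.exists
  have hR : 0 < R := by linarith
  have hL : 0 < R ^ γ := Real.rpow_pos_of_pos hR _
  have hL2 : (R ^ γ) ^ 2 = R ^ (γ * 2) := by
    rw [← Real.rpow_mul_natCast hR.le]; norm_num
  have key := hB R (R ^ γ) hR hL ?_ ?_ ?_
  · have hV : (√(R ^ (-α)) ^ (n - 1))⁻¹ * R ^ γ = R ^ (α / 2 * (n - 1) + γ) := by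
      rw [Real.sqrt_eq_rpow, ← Real.rpow_mul hR.le, ← Real.rpow_mul_natCast hR.le,
        ← Real.rpow_neg hR.le, ← Real.rpow_add hR, Nat.cast_sub (by omega)]
      congr 1
      push_cast; ring
    rw [hV, hL2, ← Real.rpow_mul hR.le, ← Real.rpow_mul hR.le, hexp,
      add_sub_cancel_left] at key
    have h1 : R ^ κ ≤ B := by
      rw [hκ, Real.rpow_sub hR, div_le_iff₀ (Real.rpow_pos_of_pos hR _)]
      exact key
    linarith
  · rw [le_div_iff₀ zero_lt_two]
    calc R ^ γ * 2 ≤ R ^ γ * R ^ (1 - γ) := by gcongr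
      _ = R := by rw [← Real.rpow_add hR]; simp
  · rw [hL2, ← Real.rpow_neg hR.le, ← Real.rpow_add hR, ← Real.rpow_sub_one hR.ne']
    exact Real.rpow_le_rpow_of_exponent_le hR1 (by linarith)
  · rw [hL2, ← Real.rpow_add hR]
    exact Real.one_le_rpow hR1 (by linarith)
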